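/- Let $\Sigma$ be a compact oriented smooth $3$-manifold without boundary and let $\mathcal V_\Sigma\to\Sigma$ be a smooth real vector bundle of rank $4$ with an $SO(3,1)$-structure, i.e. a smooth fibre metric $\eta$ of signature $(3,1)$ and a fibre orientation; use the resulting volume element to trivialize $\bigwedge^4\mathcal V_\Sigma$, so that elements of $\Omega^{3,4}_\partial$ can be integrated over $\Sigma$. Here $\Omega^{i,j}_\partial=\Omega^i(\Sigma,\bigwedge^j\mathcal V_\Sigma)$ denotes the space of smooth $i$-forms with values in $\bigwedge^j\mathcal V_\Sigma$, with its $C^\infty$ topology and with the wedge product for which $\alpha\beta=(-1)^{(i+j)(k+l)}\beta\alpha$ for $\alpha\in\Omega^{i,j}_\partial$, $\beta\in\Omega^{k,l}_\partial$. Let $e_0\in\Omega^{1,1}_\partial$ be a boundary coframe, i.e. an injective bundle map $e_0\colon T\Sigma\to\mathcal V_\Sigma$. Let $\widetilde{\mathcal F}_{LPC}=\Omega^{1,1}_\partial\times\bigl(\Omega^{1,2}_\partial/\operatorname{Ker}(e_0\wedge\cdot)\bigr)$, with elements $(b,[a])$, and let $T^*\Omega^{1,1}_\partial=\Omega^{1,1}_\partial\times\Omega^{2,3}_\partial$,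 with elements $(b,\Theta)$, where $\Theta$ is regarded as the covector $b\mapsto\int_\Sigma b\,\Theta$, with canonical form $$\varpi^\partial\bigl((b,\Theta),(b',\Theta')\bigr)=\int_\Sigma b\,\Theta'-\int_\Sigma b'\,\Theta .$$ Then $\varpi^\partial$ is a (weak) symplectic form, i.e. a continuous, bilinear, alternating and weakly non-degenerate form; the formula $$\widetilde\varpi\bigl((b,[a]),(b',[a'])\bigr)=\int_\Sigma e_0\,b\,a'-\int_\Sigma e_0\,b'\,a$$ gives a well-defined (weak) symplectic form on $\widetilde{\mathcal F}_{LPC}$; and $$\Phi\colon\widetilde{\mathcal F}_{LPC}\to T^*\Omega^{1,1}_\partial,\qquad \Phi(b,[a])=(b,\,e_0\wedge a),$$ is an isomorphism of topological vector spaces (in particular a diffeomorphism) with $\Phi^*\varpi^\partial=\widetilde\varpi$, i.e. a symplectomorphism. -/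

import Mathlib

open scoped Manifold ContDiff Topology TensorProduct
open Bundle MeasureTheory

noncomputable section

namespace LPC

/-- The model space of the three-dimensional boundary manifold. -/
abbrev E3 : Type := EuclideanSpace ℝ (Fin 3)

/-- The model fibre of the rank four bundle. -/
abbrev F4 : Type := EuclideanSpace ℝ (Fin 4)

/-! ### Wedge product on the fibres -/

section Fibre

variable {T W : Type*} [AddCommGroup T] [Module ℝ T] [AddCommGroup W] [Module ℝ W]

/-- The product `⋀^j W × ⋀^l W → ⋀^(j+l) W` of the exterior algebra. -/
def extMul (j l : ℕ) : ⋀[ℝ]^j W →ₗ[ℝ] ⋀[ℝ]^l W →ₗ[ℝ] ⋀[ℝ]^(j + l) W :=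
  LinearMap.mk₂ ℝ
    (fun u w => ⟨(u : ExteriorAlgebra ℝ W) * (w : ExteriorAlgebra ℝ W),
      SetLike.mul_mem_graded u.2 w.2⟩)
    (fun _ _ _ => Subtype.ext (add_mul _ _ _))
    (fun _ _ _ => Subtype.ext (smul_mul_assoc _ _ _))
    (fun _ _ _ => Subtype.ext (mul_add _ _ _))
    (fun _ _ _ => Subtype.ext (mul_smul_comm _ _ _))

/-- The wedge product of alternating maps with values in exterior powers: the wedge product of
forms (sum over shuffles, without further combinatorial factor) together with the product of the
exterior algebra.  The sign `(-1)^(j*k)` is the Koszul sign for moving the internal degree `j` of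
the first factor past the form degree `k` of the second one, so that elements of bidegree `(i,j)`
and `(k,l)` commute up to `(-1)^((i+j)*(k+l))` (total degree convention). -/
def fibreWedge {i j k l : ℕ} (α : T [⋀^Fin i]→ₗ[ℝ] ⋀[ℝ]^j W) (β : T [⋀^Fin k]→ₗ[ℝ] ⋀[ℝ]^l W) :
    T [⋀^Fin (i + k)]→ₗ[ℝ] ⋀[ℝ]^(j + l) W :=
  ((-1 : ℝ) ^ (j * k)) •
    ((TensorProduct.lift (extMul j l)).compAlternatingMap
      (α.domCoprod β)).domDomCongr finSumFinEquiv

theorem fibreWedge_apply {i j k l : ℕ} (α : T [⋀^Fin i]→ₗ[ℝ] ⋀[ℝ]^j W)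
    (β : T [⋀^Fin k]→ₗ[ℝ] ⋀[ℝ]^l W) (v : Fin (i + k) → T) :
    fibreWedge α β v = ((-1 : ℝ) ^ (j * k)) •
      ∑ q : Equiv.Perm.ModSumCongr (Fin i) (Fin k), ((Equiv.Perm.sign q.out : ℤ) : ℝ) •
        extMul j l (α fun n => v (finSumFinEquiv (q.out (Sum.inl n))))
          (β fun n => v (finSumFinEquiv (q.out (Sum.inr n)))) := by
  have h : ∀ (q : Equiv.Perm.ModSumCongr (Fin i) (Fin k)) (w : Fin i ⊕ Fin k → T),
      AlternatingMap.domCoprod.summand α β q w = ((Equiv.Perm.sign q.out : ℤ) : ℝ) •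
        ((α fun n => w (q.out (Sum.inl n))) ⊗ₜ[ℝ] (β fun n => w (q.out (Sum.inr n)))) := by
    intro q w
    have h1 : AlternatingMap.domCoprod.summand α β q =
        AlternatingMap.domCoprod.summand α β (Quotient.mk'' q.out) := by
      rw [Quotient.out_eq']
    rw [h1, AlternatingMap.domCoprod.summand_mk'']
    exact (Int.cast_smul_eq_zsmul ℝ (Equiv.Perm.sign q.out : ℤ)
      ((α fun n => w (q.out (Sum.inl n))) ⊗ₜ[ℝ] (β fun n => w (q.out (Sum.inr n))))).symm
  change ((-1 : ℝ) ^ (j * k)) • TensorProduct.lift (extMul j l)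
    ((α.domCoprod β) fun n => v (finSumFinEquiv n)) = _
  rw [AlternatingMap.domCoprod_apply, _root_.sum_apply, map_sum]
  congr 1
  refine Finset.sum_congr rfl fun q _ => ?_
  rw [h, map_smul, TensorProduct.lift.tmul]

theorem coe_map {W' : Type*} [AddCommGroup W'] [Module ℝ W'] (f : W →ₗ[ℝ] W') {j : ℕ}
    (u : ⋀[ℝ]^j W) :
    (exteriorPower.map j f u : ExteriorAlgebra ℝ W') = ExteriorAlgebra.map f u := by
  have h : (Submodule.subtype _).comp (exteriorPower.map j f) =
      (ExteriorAlgebra.map f).toLinearMap.comp (Submodule.subtype (⋀[ℝ]^j W)) := by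
    apply exteriorPower.linearMap_ext
    ext m
    simp [ExteriorAlgebra.map_apply_ιMulti]
  exact LinearMap.congr_fun h u

theorem fibreWedge_add {i j k l : ℕ} (α : T [⋀^Fin i]→ₗ[ℝ] ⋀[ℝ]^j W)
    (β γ : T [⋀^Fin k]→ₗ[ℝ] ⋀[ℝ]^l W) :
    fibreWedge α (β + γ) = fibreWedge α β + fibreWedge α γ := by
  ext1 v
  rw [AlternatingMap.add_apply]
  simp only [fibreWedge_apply, AlternatingMap.add_apply, map_add, smul_add, Finset.sum_add_distrib]

theorem fibreWedge_smul {i j k l : ℕ} (c : ℝ) (α : T [⋀^Fin i]→ₗ[ℝ] ⋀[ℝ]^j W)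
    (β : T [⋀^Fin k]→ₗ[ℝ] ⋀[ℝ]^l W) :
    fibreWedge α (c • β) = c • fibreWedge α β := by
  ext1 v
  rw [AlternatingMap.smul_apply]
  simp only [fibreWedge_apply, AlternatingMap.smul_apply, map_smul, Finset.smul_sum]
  refine Finset.sum_congr rfl fun q _ => ?_
  rw [smul_comm _ c, smul_comm _ c]

theorem extMul_map {W' : Type*} [AddCommGroup W'] [Module ℝ W'] (f : W →ₗ[ℝ] W') {j l : ℕ}
    (u : ⋀[ℝ]^j W) (w : ⋀[ℝ]^l W) :
    exteriorPower.map (j + l) f (extMul j l u w) =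
      extMul j l (exteriorPower.map j f u) (exteriorPower.map l f w) := by
  apply Subtype.ext
  rw [coe_map]
  change ExteriorAlgebra.map f ((u : ExteriorAlgebra ℝ W) * (w : ExteriorAlgebra ℝ W)) =
    (exteriorPower.map j f u : ExteriorAlgebra ℝ W') * (exteriorPower.map l f w)
  rw [map_mul, coe_map, coe_map]

end Fibre

/-! ### Bundle-valued forms on the boundary -/

section Forms

variable {S : Type*} [TopologicalSpace S] [ChartedSpace E3 S] [IsManifold (𝓡 3) ∞ S]
  (V : S → Type*) [TopologicalSpace (TotalSpace F4 V)] [∀ x, AddCommGroup (V x)]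
  [∀ x, Module ℝ (V x)] [∀ x, TopologicalSpace (V x)] [FiberBundle F4 V] [VectorBundle ℝ F4 V]

/-- The open set around `x₀` on which both the chart of `S` at `x₀` and the trivialization of `V`
at `x₀` are defined. -/
def nbhd (x₀ : S) : Set S := (chartAt E3 x₀).source ∩ (trivializationAt F4 V x₀).baseSet

/-- The vector of `T_x S` with coordinates `v` in the chart at `x₀` (the value at `x` of the
coordinate vector field with constant components `v`). -/
def coordVec (x₀ x : S) (v : E3) : TangentSpace (𝓡 3) x :=
  (trivializationAt E3 (TangentSpace (𝓡 3) : S → Type _) x₀).symmₗ ℝ x v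

/-- A family of elements of `Λ^i T_x^*S ⊗ ⋀^j V_x`, without any regularity in `x`. -/
abbrev RoughForm (i j : ℕ) : Type _ :=
  ∀ x : S, (TangentSpace (𝓡 3) x) [⋀^Fin i]→ₗ[ℝ] ⋀[ℝ]^j (V x)

variable {V}

/-- The local component functions of a form near `x₀`: evaluate on coordinate vector fields, read
the value in the trivialization of `V` at `x₀`, and take the component along `l`. -/
def component {i j : ℕ} (α : RoughForm V i j) (x₀ : S) (v : Fin i → E3)
    (l : Module.Dual ℝ (⋀[ℝ]^j F4)) (x : S) : ℝ :=
  l (exteriorPower.map j ((trivializationAt F4 V x₀).linearMapAt ℝ x)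
    (α x fun n => coordVec x₀ x (v n)))

variable (V)

/-- `Ω^{i,j}_∂ = Ω^i(S, ⋀^j V)`: smooth `i`-forms on `S` with values in `⋀^j V`.  Smoothness means
that all local components are smooth. -/
@[ext]
structure Form (i j : ℕ) where
  /-- The value of the form at each point. -/
  val : RoughForm V i j
  smooth : ∀ x₀ v l, ContMDiffOn (𝓡 3) 𝓘(ℝ) ∞ (component val x₀ v l) (nbhd V x₀)

variable {V}

theorem component_add {i j : ℕ} (α β : RoughForm V i j) (x₀ : S) (v : Fin i → E3)
    (l : Module.Dual ℝ (⋀[ℝ]^j F4)) :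
    component (α + β) x₀ v l = component α x₀ v l + component β x₀ v l := by
  funext x; simp [component]

theorem component_smul {i j : ℕ} (c : ℝ) (α : RoughForm V i j) (x₀ : S) (v : Fin i → E3)
    (l : Module.Dual ℝ (⋀[ℝ]^j F4)) :
    component (c • α) x₀ v l = fun x => c * component α x₀ v l x := by
  funext x; simp [component]

/-! The vector space structure on `Ω^{i,j}_∂` is the pointwise one. -/

instance {i j : ℕ} : Zero (Form V i j) :=
  ⟨⟨0, fun x₀ v l => by
    have h : component (0 : RoughForm V i j) x₀ v l = fun _ => 0 := by
      funext x; simp [component]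
    rw [h]; exact contMDiffOn_const⟩⟩

instance {i j : ℕ} : Add (Form V i j) :=
  ⟨fun α β => ⟨α.val + β.val, fun x₀ v l => by
    rw [component_add]; exact (α.smooth x₀ v l).add (β.smooth x₀ v l)⟩⟩

instance {i j : ℕ} : Neg (Form V i j) :=
  ⟨fun α => ⟨-α.val, fun x₀ v l => by
    have h : component (-α.val) x₀ v l = fun x => -component α.val x₀ v l x := by
      funext x; simp [component]
    rw [h]; exact (α.smooth x₀ v l).neg⟩⟩

instance {i j : ℕ} : SMul ℝ (Form V i j) :=
  ⟨fun c α => ⟨c • α.val, fun x₀ v l => by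
    rw [component_smul]; exact contMDiffOn_const.mul (α.smooth x₀ v l)⟩⟩

theorem val_zero {i j : ℕ} : (0 : Form V i j).val = 0 := rfl

theorem val_add {i j : ℕ} (α β : Form V i j) : (α + β).val = α.val + β.val := rfl

theorem val_neg {i j : ℕ} (α : Form V i j) : (-α).val = -α.val := rfl

theorem val_smul {i j : ℕ} (c : ℝ) (α : Form V i j) : (c • α).val = c • α.val := rfl

instance {i j : ℕ} : AddCommGroup (Form V i j) where
  add_assoc α β γ := Form.ext (add_assoc α.val β.val γ.val)
  zero_add α := Form.ext (zero_add α.val)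
  add_zero α := Form.ext (add_zero α.val)
  add_comm α β := Form.ext (add_comm α.val β.val)
  neg_add_cancel α := Form.ext (neg_add_cancel α.val)
  nsmul := nsmulRec
  zsmul := zsmulRec

instance {i j : ℕ} : Module ℝ (Form V i j) where
  one_smul α := Form.ext (one_smul ℝ α.val)
  mul_smul c d α := Form.ext (mul_smul c d α.val)
  smul_zero c := Form.ext (smul_zero c)
  smul_add c α β := Form.ext (smul_add c α.val β.val)
  add_smul c d α := Form.ext (add_smul c d α.val)
  zero_smul α := Form.ext (zero_smul ℝ α.val)

/-- The `C^∞` topology on `Ω^{i,j}_∂`: uniform convergence on compact subsets of coordinate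
neighbourhoods of all partial derivatives of all local components. -/
instance {i j : ℕ} : TopologicalSpace (Form V i j) :=
  ⨅ (x₀ : S) (v : Fin i → E3) (l : Module.Dual ℝ (⋀[ℝ]^j F4)) (k : ℕ),
    TopologicalSpace.induced
      (fun α : Form V i j =>
        UniformOnFun.ofFun {K : Set E3 | IsCompact K ∧ K ⊆ chartAt E3 x₀ '' nbhd V x₀}
          (iteratedFDeriv ℝ k (component α.val x₀ v l ∘ (chartAt E3 x₀).symm)))
      inferInstance

theorem component_wedge {i j k l : ℕ} (α : RoughForm V i j) (β : RoughForm V k l) (x₀ : S)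
    (v : Fin (i + k) → E3) (m : Module.Dual ℝ (⋀[ℝ]^(j + l) F4)) :
    component (fun x => fibreWedge (α x) (β x)) x₀ v m = fun x =>
      ((-1 : ℝ) ^ (j * k)) *
      ∑ q : Equiv.Perm.ModSumCongr (Fin i) (Fin k), ((Equiv.Perm.sign q.out : ℤ) : ℝ) *
        ∑ a, ∑ b,
          component α x₀ (fun n => v (finSumFinEquiv (q.out (Sum.inl n))))
            ((Module.finBasis ℝ (⋀[ℝ]^j F4)).coord a) x *
          component β x₀ (fun n => v (finSumFinEquiv (q.out (Sum.inr n))))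
            ((Module.finBasis ℝ (⋀[ℝ]^l F4)).coord b) x *
          m (extMul j l (Module.finBasis ℝ (⋀[ℝ]^j F4) a) (Module.finBasis ℝ (⋀[ℝ]^l F4) b)) := by
  funext x
  have key : ∀ (u : ⋀[ℝ]^j F4) (w : ⋀[ℝ]^l F4), m (extMul j l u w) =
      ∑ a, ∑ b, (Module.finBasis ℝ (⋀[ℝ]^j F4)).coord a u *
        (Module.finBasis ℝ (⋀[ℝ]^l F4)).coord b w *
        m (extMul j l (Module.finBasis ℝ (⋀[ℝ]^j F4) a) (Module.finBasis ℝ (⋀[ℝ]^l F4) b)) := by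
    intro u w
    conv_lhs => rw [← (Module.finBasis ℝ (⋀[ℝ]^j F4)).sum_repr u,
      ← (Module.finBasis ℝ (⋀[ℝ]^l F4)).sum_repr w]
    simp only [map_sum, map_smul, LinearMap.sum_apply, LinearMap.smul_apply, smul_eq_mul,
      Module.Basis.coord_apply, Finset.mul_sum]
    rw [Finset.sum_comm]
    refine Finset.sum_congr rfl fun a _ => Finset.sum_congr rfl fun b _ => ?_
    ring
  simp only [component, fibreWedge_apply, map_smul, map_sum, smul_eq_mul, extMul_map]
  congr 1
  refine Finset.sum_congr rfl fun q _ => ?_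
  rw [key]

/-- The wedge product `Ω^{i,j}_∂ × Ω^{k,l}_∂ → Ω^{i+k,j+l}_∂`. -/
def wedge {i j k l : ℕ} (α : Form V i j) (β : Form V k l) : Form V (i + k) (j + l) where
  val x := fibreWedge (α.val x) (β.val x)
  smooth x₀ v m := by
    rw [component_wedge]
    refine contMDiffOn_const.mul (contMDiffOn_finsetSum fun q _ => contMDiffOn_const.mul
      (contMDiffOn_finsetSum fun a _ => contMDiffOn_finsetSum fun b _ => ?_))
    exact ((α.smooth _ _ _).mul (β.smooth _ _ _)).mul contMDiffOn_const

/-- The linear map `e₀ ∧ · : Ω^{i,j}_∂ → Ω^{i+1,j+1}_∂`. -/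
def wedgeLeft (e₀ : Form V 1 1) (i j : ℕ) : Form V i j →ₗ[ℝ] Form V (1 + i) (1 + j) where
  toFun := wedge e₀
  map_add' α β := Form.ext (funext fun x => fibreWedge_add (e₀.val x) (α.val x) (β.val x))
  map_smul' c α := Form.ext (funext fun x => fibreWedge_smul c (e₀.val x) (α.val x))

/-- A `V`-valued one-form `e₀` is a boundary coframe if it is an injective bundle map `TS → V`
(here `⋀^1 V = V`). -/
def IsBoundaryCoframe (e₀ : Form V 1 1) : Prop :=
  ∀ x : S, Function.Injective fun v : TangentSpace (𝓡 3) x => e₀.val x fun _ => v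

variable (V)

/-- A smooth `SO(3,1)`-structure on `V`: a smooth fibre metric `metric` and a smooth fibrewise volume
form `vol` such that each fibre has a basis which is orthonormal of signature `(3,1)` and on which
`vol` is one.  Thus `vol` is the volume form of a Lorentzian metric and an orientation of `V`. -/
structure LorentzStructure where
  /-- The fibre metric. -/
  metric : ∀ x : S, V x →ₗ[ℝ] V x →ₗ[ℝ] ℝ
  /-- The fibrewise volume form. -/
  vol : ∀ x : S, V x [⋀^Fin 4]→ₗ[ℝ] ℝ
  metric_smooth : ∀ (x₀ : S) (u w : F4), ContMDiffOn (𝓡 3) 𝓘(ℝ) ∞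
    (fun x => metric x ((trivializationAt F4 V x₀).symmₗ ℝ x u)
      ((trivializationAt F4 V x₀).symmₗ ℝ x w)) (trivializationAt F4 V x₀).baseSet
  vol_smooth : ∀ (x₀ : S) (u : Fin 4 → F4), ContMDiffOn (𝓡 3) 𝓘(ℝ) ∞
    (fun x => vol x fun n => (trivializationAt F4 V x₀).symmₗ ℝ x (u n))
    (trivializationAt F4 V x₀).baseSet
  exists_frame : ∀ x : S, ∃ f : Module.Basis (Fin 4) ℝ (V x),
    (∀ a b, metric x (f a) (f b) = if a = b then (if a = 3 then -1 else 1) else 0) ∧ vol x f = 1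

end Forms

/-! ### Orientation and integration -/

section Integration

variable {S : Type*} [TopologicalSpace S] [ChartedSpace E3 S] [IsManifold (𝓡 3) ∞ S]

/-- The coordinate vector fields `∂_1, ∂_2, ∂_3` of the chart at `x₀`, at the point `x`. -/
def coordFrame (x₀ x : S) (n : Fin 3) : TangentSpace (𝓡 3) x :=
  coordVec x₀ x (EuclideanSpace.basisFun (Fin 3) ℝ n)

open Classical in
/-- The sign (`1` or `-1`) of the coordinate frame of the chart at `x₀` with respect to given
orientations of the tangent spaces, at a point `x` of the chart domain. -/
def coordSign (o : ∀ x : S, Orientation ℝ (TangentSpace (𝓡 3) x) (Fin 3)) (x₀ x : S) : ℝ :=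
  if ∃ f : Module.Basis (Fin 3) ℝ (TangentSpace (𝓡 3) x),
    (∀ n, f n = coordFrame x₀ x n) ∧ f.orientation = o x then 1 else -1

variable (S) in
/-- An orientation of the three-manifold `S`: orientations of the tangent spaces, locally constant in
charts. -/
structure ManifoldOrientation where
  /-- The orientation of each tangent space. -/
  orient : ∀ x : S, Orientation ℝ (TangentSpace (𝓡 3) x) (Fin 3)
  locallyConstant : ∀ x₀ : S, ContinuousOn (coordSign orient x₀) (chartAt E3 x₀).source

variable (S) in
/-- A smooth partition of unity on `S` subordinate to the chart domains. -/
def chartPartition [T2Space S] [SigmaCompactSpace S] : SmoothPartitionOfUnity S (𝓡 3) S Set.univ :=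
  (SmoothPartitionOfUnity.exists_isSubordinate_chartAt_source (𝓡 3) S).choose

theorem chartPartition_isSubordinate [T2Space S] [SigmaCompactSpace S] :
    (chartPartition S).IsSubordinate fun x => (chartAt E3 x).source :=
  (SmoothPartitionOfUnity.exists_isSubordinate_chartAt_source (𝓡 3) S).choose_spec

variable {V : S → Type*} [TopologicalSpace (TotalSpace F4 V)] [∀ x, AddCommGroup (V x)]
  [∀ x, Module ℝ (V x)] [∀ x, TopologicalSpace (V x)] [FiberBundle F4 V] [VectorBundle ℝ F4 V]

/-- The coefficient of `dx¹dx²dx³` of the density defined by an element of `Ω^{3,4}_∂`, in the chart at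
`x₀`: `⋀^4 V` is trivialized by the volume form, and the sign compares the chart with the
orientation. -/
def density (o : ManifoldOrientation S) (L : LorentzStructure V) (η : Form V 3 4) (x₀ x : S) : ℝ :=
  coordSign o.orient x₀ x *
    exteriorPower.alternatingMapLinearEquiv (L.vol x) (η.val x (coordFrame x₀ x))

/-- The integral over `S` of an element of `Ω^{3,4}_∂`, by a partition of unity subordinate to
charts. -/
def formIntegral [T2Space S] [SigmaCompactSpace S] (o : ManifoldOrientation S) (L : LorentzStructure V)
    (η : Form V 3 4) : ℝ :=
  ∑ᶠ x₀ : S, ∫ y in (chartAt E3 x₀).target,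
    chartPartition S x₀ ((chartAt E3 x₀).symm y) * density o L η x₀ ((chartAt E3 x₀).symm y)

end Integration

/-! ### Phase spaces -/

/-- A symplectic form on a topological vector space: a continuous bilinear alternating form which is
(weakly) non-degenerate.  As a two-form with constant coefficients it is closed. -/
structure IsSymplecticForm {E : Type*} [AddCommGroup E] [Module ℝ E] [TopologicalSpace E]
    (σ : E → E → ℝ) : Prop where
  bilinear : ∃ B : E →ₗ[ℝ] E →ₗ[ℝ] ℝ, ∀ p q, σ p q = B p q
  continuous : Continuous fun p : E × E => σ p.1 p.2
  alternating : ∀ p, σ p p = 0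
  nondegenerate : ∀ p, (∀ q, σ p q = 0) → p = 0

section PhaseSpace

variable {S : Type*} [TopologicalSpace S] [ChartedSpace E3 S] [IsManifold (𝓡 3) ∞ S]
  (V : S → Type*) [TopologicalSpace (TotalSpace F4 V)] [∀ x, AddCommGroup (V x)]
  [∀ x, Module ℝ (V x)] [∀ x, TopologicalSpace (V x)] [FiberBundle F4 V] [VectorBundle ℝ F4 V]

/-- The cotangent bundle `T^*Ω^{1,1}_∂ = Ω^{1,1}_∂ × Ω^{2,3}_∂`, with base coordinate `b` and fibre
coordinate `Θ`; the covector `Θ` is the functional `b ↦ ∫ b ∧ Θ`. -/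
abbrev CotangentSpace : Type _ := Form V 1 1 × Form V 2 3

variable {V}

/-- The geometric phase space of the linearized theory: pairs `(b, [a])`, with `b ∈ Ω^{1,1}_∂` and
`[a]` the class of `a ∈ Ω^{1,2}_∂` modulo the kernel of `e₀ ∧ ·`. -/
abbrev PhaseSpace (e₀ : Form V 1 1) : Type _ :=
  Form V 1 1 × (Form V 1 2 ⧸ LinearMap.ker (wedgeLeft e₀ 1 2))

variable [T2Space S] [SigmaCompactSpace S]

/-- The tautological one-form of `T^*Ω^{1,1}_∂`: at `p = (b, Θ)`, on the tangent vector
`q = (b', Θ')`, it is `Θ(b') = ∫ b' ∧ Θ`. -/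
def tautologicalForm (o : ManifoldOrientation S) (L : LorentzStructure V)
    (p q : CotangentSpace V) : ℝ :=
  formIntegral o L (wedge q.1 p.2)

/-- The canonical symplectic form `∫ δb δΘ` of `T^*Ω^{1,1}_∂`, which is minus the differential of the
tautological one-form. -/
def canonicalForm (o : ManifoldOrientation S) (L : LorentzStructure V)
    (p q : CotangentSpace V) : ℝ :=
  tautologicalForm o L q p - tautologicalForm o L p q

/-- The two-form `∫ e₀ δb δa` on the space of pairs `(b, a)`. -/
def preForm (o : ManifoldOrientation S) (L : LorentzStructure V) (e₀ : Form V 1 1)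
    (p q : Form V 1 1 × Form V 1 2) : ℝ :=
  formIntegral o L (wedge (wedge e₀ p.1) q.2) - formIntegral o L (wedge (wedge e₀ q.1) p.2)

end PhaseSpace

end LPC

end

/-! Two facts of linear algebra in a single fibre carry the theorem, together with their passage to
smooth sections. The first is that for an injective `e` the map `e ∧ ·` from `T^* ⊗ ⋀²W` to `⋀²T^* ⊗
⋀³W` is onto when `dim T = 3` and `dim W = 4` (`fibreWedge_surjective`). The second is that the
pairing of `T^* ⊗ W` with `⋀²T^* ⊗ ⋀³W` into the top degree is non-degenerate on both sides
(`exists_wedge_oneForm_ne_zero`, `exists_wedge_twoForm_ne_zero`).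

By the first fact, `Φ` is a continuous linear bijection. Continuity of its inverse comes from a
continuous right inverse of `e₀ ∧ ·` on sections (`exists_continuous_rightInverse`), so no open
mapping argument is needed. By compactness finitely many forms `β k` span every source fibre, hence
the `e₀ ∧ β k` span every target fibre. The coefficients of least Euclidean norm expressing `Θ`
through `e₀ ∧ β k` are unique, so they do not depend on the chart; in each chart they are given by
the pseudoinverse, a smooth matrix. Applying the same coefficients to the `β k` gives the right
inverse.

By the second fact, a form that is non-zero at a point has a smooth partner whose product with it
has non-zero density there. A bump function concentrates the integral where that density has one
sign (`exists_formIntegral_ne_zero`), which gives weak non-degeneracy of the canonical form. Its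
continuity uses only the joint continuity of densities in the form and the point
(`JointlyContinuous.continuous_formIntegral`).

The form on the phase space is then taken to be the pullback along `Φ`, so it is symplectic and well
defined on classes. Its formula is the identity `b (e₀ a) = (e₀ b) a`, valid because `b` and `e₀`
have even total degree (`fibreWedge_left_comm`). -/

noncomputable section

namespace LPC

set_option linter.unusedSectionVars false

/-! ### Explicit formulas for the fibrewise wedge product in low degree -/

section FibreAlgebra

variable {T W : Type*} [AddCommGroup T] [Module ℝ T] [AddCommGroup W] [Module ℝ W]

@[simp]
theorem coe_extMul {j l : ℕ} (u : ⋀[ℝ]^j W) (w : ⋀[ℝ]^l W) :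
    (extMul j l u w : ExteriorAlgebra ℝ W) = u * w := rfl

/-- The wedge product as a sum over all permutations. -/
theorem factorial_smul_fibreWedge {i j k l : ℕ} (α : T [⋀^Fin i]→ₗ[ℝ] ⋀[ℝ]^j W)
    (β : T [⋀^Fin k]→ₗ[ℝ] ⋀[ℝ]^l W) (v : Fin (i + k) → T) :
    ((i.factorial * k.factorial : ℕ) : ℝ) • fibreWedge α β v = ((-1 : ℝ) ^ (j * k)) •
      ∑ σ : Equiv.Perm (Fin (i + k)), ((Equiv.Perm.sign σ : ℤ) : ℝ) •
        extMul j l (α fun n => v (σ (Fin.castAdd k n))) (β fun n => v (σ (Fin.natAdd i n))) := by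
  -- Alternating the plain tensor product counts each shuffle class `i! * k!` times; the resulting
  -- sum involves no chosen coset representatives and can be evaluated.
  have h := MultilinearMap.domCoprod_alternization_eq α β
  have h2 : ((i.factorial * k.factorial : ℕ) : ℝ) • (α.domCoprod β) (fun n => v (finSumFinEquiv n))
      = ∑ σ : Equiv.Perm (Fin i ⊕ Fin k), ((Equiv.Perm.sign σ : ℤ) : ℝ) •
        ((α fun n => v (finSumFinEquiv (σ (Sum.inl n)))) ⊗ₜ[ℝ]
          (β fun n => v (finSumFinEquiv (σ (Sum.inr n))))) := by
    have h3 := congrArg (fun f => f (fun n => v (finSumFinEquiv n))) h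
    simp only [Fintype.card_fin, AlternatingMap.smul_apply] at h3
    rw [Nat.cast_smul_eq_nsmul, ← h3, MultilinearMap.alternatization_apply]
    refine Finset.sum_congr rfl fun σ _ => ?_
    simp only [MultilinearMap.domDomCongr_apply, MultilinearMap.domCoprod_apply]
    exact (Int.cast_smul_eq_zsmul ℝ (Equiv.Perm.sign σ : ℤ)
      ((α fun n => v (finSumFinEquiv (σ (Sum.inl n)))) ⊗ₜ[ℝ]
        (β fun n => v (finSumFinEquiv (σ (Sum.inr n)))))).symm
  change _ • ((-1 : ℝ) ^ (j * k)) • TensorProduct.lift (extMul j l)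
    ((α.domCoprod β) fun n => v (finSumFinEquiv n)) = _
  rw [smul_comm, ← map_smul, h2, map_sum]
  congr 1
  refine Fintype.sum_equiv (Equiv.permCongr finSumFinEquiv) _ _ fun σ => ?_
  rw [map_smul, TensorProduct.lift.tmul]
  simp [Equiv.permCongr_apply]

theorem sum_perm_fin_two {M : Type*} [AddCommGroup M] (f : Equiv.Perm (Fin 2) → M) :
    ∑ σ, f σ = f 1 + f (Equiv.swap 0 1) := by
  have h : (Finset.univ : Finset (Equiv.Perm (Fin 2))) = {1, Equiv.swap 0 1} := by decide
  rw [h, Finset.sum_pair (by decide)]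

theorem sum_perm_fin_three {M : Type*} [AddCommGroup M] (f : Equiv.Perm (Fin 3) → M) :
    ∑ σ, f σ = f 1 + f (Equiv.swap 0 1) + f (Equiv.swap 0 2) + f (Equiv.swap 1 2) +
      f (Equiv.swap 0 1 * Equiv.swap 1 2) + f (Equiv.swap 1 2 * Equiv.swap 0 1) := by
  have h : (Finset.univ : Finset (Equiv.Perm (Fin 3))) = {1, Equiv.swap 0 1, Equiv.swap 0 2,
    Equiv.swap 1 2, Equiv.swap 0 1 * Equiv.swap 1 2, Equiv.swap 1 2 * Equiv.swap 0 1} := by decide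
  rw [h]
  repeat rw [Finset.sum_insert (by decide)]
  rw [Finset.sum_singleton]
  abel

theorem fibreWedge_one_one {j l : ℕ} (α : T [⋀^Fin 1]→ₗ[ℝ] ⋀[ℝ]^j W)
    (β : T [⋀^Fin 1]→ₗ[ℝ] ⋀[ℝ]^l W) (u v : T) :
    fibreWedge α β ![u, v] = ((-1 : ℝ) ^ j) •
      (extMul j l (α ![u]) (β ![v]) - extMul j l (α ![v]) (β ![u])) := by
  have h := factorial_smul_fibreWedge α β ![u, v]
  have e : ∀ σ : Equiv.Perm (Fin (1 + 1)),
      extMul j l (α fun n => (![u, v] : Fin (1 + 1) → T) (σ (Fin.castAdd 1 n)))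
        (β fun n => (![u, v] : Fin (1 + 1) → T) (σ (Fin.natAdd 1 n))) =
      extMul j l (α ![(![u, v] : Fin 2 → T) (σ 0)]) (β ![(![u, v] : Fin 2 → T) (σ 1)]) := by
    intro σ
    congr 2
    · congr 1; funext n; fin_cases n; rfl
    · funext n; fin_cases n; rfl
  simp only [e] at h
  rw [show (∑ σ : Equiv.Perm (Fin (1 + 1)), ((Equiv.Perm.sign σ : ℤ) : ℝ) •
    extMul j l (α ![(![u, v] : Fin 2 → T) (σ 0)]) (β ![(![u, v] : Fin 2 → T) (σ 1)])) = _ from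
    sum_perm_fin_two _] at h
  simp only [Equiv.Perm.coe_one, id, Equiv.swap_apply_left, Equiv.swap_apply_right,
    Equiv.Perm.sign_one, Equiv.Perm.sign_swap (show (0 : Fin 2) ≠ 1 by decide), Matrix.cons_val,
    mul_one, Nat.factorial_one, Nat.cast_one, one_smul, Units.val_one, Units.val_neg, Int.cast_neg,
    Int.cast_one] at h
  rw [h]
  module

theorem alternating_swap {N : Type*} [AddCommGroup N] [Module ℝ N] (β : T [⋀^Fin 2]→ₗ[ℝ] N)
    (u v : T) : β ![v, u] = -β ![u, v] := by
  have h := β.map_swap (v := ![u, v]) (i := 0) (j := 1) (by decide)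
  rw [← h]
  congr 1
  funext n
  fin_cases n <;> rfl

theorem fibreWedge_one_two {j l : ℕ} (α : T [⋀^Fin 1]→ₗ[ℝ] ⋀[ℝ]^j W)
    (β : T [⋀^Fin 2]→ₗ[ℝ] ⋀[ℝ]^l W) (u v w : T) :
    fibreWedge α β ![u, v, w] = extMul j l (α ![u]) (β ![v, w]) -
      extMul j l (α ![v]) (β ![u, w]) + extMul j l (α ![w]) (β ![u, v]) := by
  have h := factorial_smul_fibreWedge α β ![u, v, w]
  have e : ∀ σ : Equiv.Perm (Fin (1 + 2)),
      extMul j l (α fun n => (![u, v, w] : Fin (1 + 2) → T) (σ (Fin.castAdd 2 n)))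
        (β fun n => (![u, v, w] : Fin (1 + 2) → T) (σ (Fin.natAdd 1 n))) =
      extMul j l (α ![(![u, v, w] : Fin 3 → T) (σ 0)])
        (β ![(![u, v, w] : Fin 3 → T) (σ 1), (![u, v, w] : Fin 3 → T) (σ 2)]) := by
    intro σ
    congr 2
    · congr 1; funext n; fin_cases n; rfl
    · funext n; fin_cases n <;> rfl
  simp only [e] at h
  rw [show (∑ σ : Equiv.Perm (Fin (1 + 2)), ((Equiv.Perm.sign σ : ℤ) : ℝ) •
    extMul j l (α ![(![u, v, w] : Fin 3 → T) (σ 0)])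
      (β ![(![u, v, w] : Fin 3 → T) (σ 1), (![u, v, w] : Fin 3 → T) (σ 2)])) = _ from
    sum_perm_fin_three _] at h
  have s1 : (Equiv.swap (0 : Fin 3) 1) 2 = 2 := by decide
  have s2 : (Equiv.swap (0 : Fin 3) 2) 1 = 1 := by decide
  have s3 : (Equiv.swap (1 : Fin 3) 2) 0 = 0 := by decide
  -- The Koszul sign is trivial because `β` has even form degree.
  have g0 : ((-1 : ℝ) ^ (j * 2)) = 1 := by rw [mul_comm, pow_mul]; simp
  simp only [Equiv.Perm.coe_one, id, Equiv.Perm.coe_mul, Function.comp, Equiv.swap_apply_left,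
    Equiv.swap_apply_right, s1, s2, s3, Equiv.Perm.sign_one, Equiv.Perm.sign_mul,
    Equiv.Perm.sign_swap (show (0 : Fin 3) ≠ 1 by decide),
    Equiv.Perm.sign_swap (show (0 : Fin 3) ≠ 2 by decide),
    Equiv.Perm.sign_swap (show (1 : Fin 3) ≠ 2 by decide), Matrix.cons_val, g0, one_smul] at h
  rw [alternating_swap β v w, alternating_swap β u w, alternating_swap β u v] at h
  -- The six permutations pair up under exchange of the two arguments of `β`; the resulting factor
  -- `1! * 2!` is cancelled at the end.
  have h2 : (2 : ℝ) • fibreWedge α β ![u, v, w] = (2 : ℝ) • (extMul j l (α ![u]) (β ![v, w]) -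
      extMul j l (α ![v]) (β ![u, w]) + extMul j l (α ![w]) (β ![u, v])) := by
    rw [show (2 : ℝ) = ((Nat.factorial 1 * Nat.factorial 2 : ℕ) : ℝ) by simp, h]
    simp only [Units.val_one, Units.val_neg, Units.val_mul, Int.cast_neg, Int.cast_one,
      Int.cast_mul, map_neg, Nat.factorial_one, Nat.factorial_two, Nat.cast_mul, Nat.cast_one,
      Nat.cast_ofNat]
    module
  exact (smul_right_injective _ (two_ne_zero' ℝ)) h2

theorem fibreWedge_two_one {j l : ℕ} (α : T [⋀^Fin 2]→ₗ[ℝ] ⋀[ℝ]^j W)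
    (β : T [⋀^Fin 1]→ₗ[ℝ] ⋀[ℝ]^l W) (u v w : T) :
    fibreWedge α β ![u, v, w] = ((-1 : ℝ) ^ j) • (extMul j l (α ![u, v]) (β ![w]) -
      extMul j l (α ![u, w]) (β ![v]) + extMul j l (α ![v, w]) (β ![u])) := by
  have h := factorial_smul_fibreWedge α β ![u, v, w]
  have e : ∀ σ : Equiv.Perm (Fin (2 + 1)),
      extMul j l (α fun n => (![u, v, w] : Fin (2 + 1) → T) (σ (Fin.castAdd 1 n)))
        (β fun n => (![u, v, w] : Fin (2 + 1) → T) (σ (Fin.natAdd 2 n))) =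
      extMul j l (α ![(![u, v, w] : Fin 3 → T) (σ 0), (![u, v, w] : Fin 3 → T) (σ 1)])
        (β ![(![u, v, w] : Fin 3 → T) (σ 2)]) := by
    intro σ
    congr 2
    · congr 1; funext n; fin_cases n <;> rfl
    · funext n; fin_cases n; rfl
  simp only [e] at h
  rw [show (∑ σ : Equiv.Perm (Fin (2 + 1)), ((Equiv.Perm.sign σ : ℤ) : ℝ) •
    extMul j l (α ![(![u, v, w] : Fin 3 → T) (σ 0), (![u, v, w] : Fin 3 → T) (σ 1)])
      (β ![(![u, v, w] : Fin 3 → T) (σ 2)])) = _ from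
    sum_perm_fin_three _] at h
  have s1 : (Equiv.swap (0 : Fin 3) 1) 2 = 2 := by decide
  have s2 : (Equiv.swap (0 : Fin 3) 2) 1 = 1 := by decide
  have s3 : (Equiv.swap (1 : Fin 3) 2) 0 = 0 := by decide
  simp only [Equiv.Perm.coe_one, id, Equiv.Perm.coe_mul, Function.comp, Equiv.swap_apply_left,
    Equiv.swap_apply_right, s1, s2, s3, Equiv.Perm.sign_one, Equiv.Perm.sign_mul,
    Equiv.Perm.sign_swap (show (0 : Fin 3) ≠ 1 by decide),
    Equiv.Perm.sign_swap (show (0 : Fin 3) ≠ 2 by decide),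
    Equiv.Perm.sign_swap (show (1 : Fin 3) ≠ 2 by decide), Matrix.cons_val, mul_one] at h
  rw [alternating_swap α v w, alternating_swap α u w, alternating_swap α u v] at h
  have h2 : (2 : ℝ) • fibreWedge α β ![u, v, w] = (2 : ℝ) • ((-1 : ℝ) ^ j) •
      (extMul j l (α ![u, v]) (β ![w]) -
      extMul j l (α ![u, w]) (β ![v]) + extMul j l (α ![v, w]) (β ![u])) := by
    rw [show (2 : ℝ) = ((Nat.factorial 2 * Nat.factorial 1 : ℕ) : ℝ) by simp, h]
    simp only [Units.val_one, Units.val_neg, Units.val_mul, Int.cast_neg, Int.cast_one,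
      Int.cast_mul, map_neg, LinearMap.neg_apply, Nat.factorial_one, Nat.factorial_two,
      Nat.cast_mul, Nat.cast_one, Nat.cast_ofNat]
    module
  exact (smul_right_injective _ (two_ne_zero' ℝ)) h2

theorem exists_coe_eq_ι (x : ⋀[ℝ]^1 W) : ∃ w : W, (x : ExteriorAlgebra ℝ W) =
    ExteriorAlgebra.ι ℝ w := by
  have h1 : (⋀[ℝ]^1 W) = LinearMap.range (ExteriorAlgebra.ι ℝ) := pow_one _
  have h : (x : ExteriorAlgebra ℝ W) ∈ LinearMap.range (ExteriorAlgebra.ι ℝ) :=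
    (SetLike.ext_iff.1 h1 _).1 x.2
  obtain ⟨w, hw⟩ := h
  exact ⟨w, hw.symm⟩

theorem ι_mul_ι_comm (u v : W) : ExteriorAlgebra.ι ℝ u * ExteriorAlgebra.ι ℝ v =
    -(ExteriorAlgebra.ι ℝ v * ExteriorAlgebra.ι ℝ u) :=
  eq_neg_of_add_eq_zero_left (ExteriorAlgebra.ι_add_mul_swap u v)

theorem eq_vec_one {N : Type*} (v : Fin 1 → N) : v = ![v 0] := by
  funext n; fin_cases n; rfl

theorem eq_vec_two {N : Type*} (v : Fin 2 → N) : v = ![v 0, v 1] := by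
  funext n; fin_cases n <;> rfl

theorem eq_vec_three {N : Type*} (v : Fin 3 → N) : v = ![v 0, v 1, v 2] := by
  funext n; fin_cases n <;> rfl

theorem eq_vec_four {N : Type*} (v : Fin 4 → N) : v = ![v 0, v 1, v 2, v 3] := by
  funext n; fin_cases n <;> rfl

/-- Graded commutativity and associativity of the wedge product in the bidegrees
`(1,1)`, `(1,1)`, `(1,2)`. -/
theorem fibreWedge_left_comm (b e : T [⋀^Fin 1]→ₗ[ℝ] ⋀[ℝ]^1 W) (a : T [⋀^Fin 1]→ₗ[ℝ] ⋀[ℝ]^2 W) :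
    (fibreWedge b (fibreWedge e a) : T [⋀^Fin 3]→ₗ[ℝ] ⋀[ℝ]^4 W) =
      fibreWedge (fibreWedge e b) a := by
  ext1 v
  rw [eq_vec_three v]
  generalize v 0 = x, v 1 = y, v 2 = z
  apply Subtype.ext
  have h1 := fibreWedge_one_two b (fibreWedge e a) x y z
  have h2 := fibreWedge_two_one (fibreWedge e b) a x y z
  have e1 := congrArg (Subtype.val) h1
  have e2 := congrArg (Subtype.val) h2
  refine e1.trans (Eq.trans ?_ e2.symm)
  have k1 : ∀ p q, ((fibreWedge e a ![p, q] : ⋀[ℝ]^(1 + 2) W) : ExteriorAlgebra ℝ W) =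
      -((e ![p] : ⋀[ℝ]^1 W) * (a ![q] : ⋀[ℝ]^2 W) - (e ![q] : ⋀[ℝ]^1 W) * (a ![p] : ⋀[ℝ]^2 W)) := by
    intro p q
    rw [fibreWedge_one_one, pow_one]
    exact neg_one_smul ℝ (((e ![p] : ⋀[ℝ]^1 W) : ExteriorAlgebra ℝ W) * (a ![q] : ⋀[ℝ]^2 W) -
      (e ![q] : ⋀[ℝ]^1 W) * (a ![p] : ⋀[ℝ]^2 W))
  have k2 : ∀ p q, ((fibreWedge e b ![p, q] : ⋀[ℝ]^(1 + 1) W) : ExteriorAlgebra ℝ W) =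
      -((e ![p] : ⋀[ℝ]^1 W) * (b ![q] : ⋀[ℝ]^1 W) - (e ![q] : ⋀[ℝ]^1 W) * (b ![p] : ⋀[ℝ]^1 W)) := by
    intro p q
    rw [fibreWedge_one_one, pow_one]
    exact neg_one_smul ℝ (((e ![p] : ⋀[ℝ]^1 W) : ExteriorAlgebra ℝ W) * (b ![q] : ⋀[ℝ]^1 W) -
      (e ![q] : ⋀[ℝ]^1 W) * (b ![p] : ⋀[ℝ]^1 W))
  -- Vectors anticommute in the exterior algebra. The trailing factor `r` lets the rule move every
  -- `b` behind the adjacent `e` inside triple products, after which both sides are combinations of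
  -- the same monomials.
  have c : ∀ p q, ∀ r : ExteriorAlgebra ℝ W, ((b ![p] : ⋀[ℝ]^1 W) : ExteriorAlgebra ℝ W) *
      ((e ![q] : ⋀[ℝ]^1 W) * r) =
      -(((e ![q] : ⋀[ℝ]^1 W) : ExteriorAlgebra ℝ W) * ((b ![p] : ⋀[ℝ]^1 W) * r)) := by
    intro p q r
    obtain ⟨w, hw⟩ := exists_coe_eq_ι (b ![p])
    obtain ⟨w', hw'⟩ := exists_coe_eq_ι (e ![q])
    rw [hw, hw', ← mul_assoc, ι_mul_ι_comm, neg_mul, mul_assoc]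
  simp only [Submodule.coe_add, Submodule.coe_sub, coe_extMul, k1, k2, mul_neg,
    neg_mul, mul_sub, sub_mul, mul_assoc, c, Even.neg_one_pow (show Even (1 + 1) from ⟨1, rfl⟩), one_smul]
  noncomm_ring

/-! ### Surjectivity and non-degeneracy in a single fibre -/

theorem exists_coe_three_eq (f : Module.Basis (Fin 4) ℝ W) (θ : ⋀[ℝ]^3 W) :
    ∃ a b c d : ℝ, θ = a • exteriorPower.ιMulti ℝ 3 ![f 0, f 1, f 2] +
      b • exteriorPower.ιMulti ℝ 3 ![f 0, f 1, f 3] +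
      c • exteriorPower.ιMulti ℝ 3 ![f 0, f 2, f 3] +
      d • exteriorPower.ιMulti ℝ 3 ![f 1, f 2, f 3] := by
  have hθ : θ ∈ Submodule.span ℝ (Set.range (exteriorPower.ιMulti_family ℝ 3 f)) := by
    rw [exteriorPower.ιMulti_family_span_of_span]
    · trivial
    · exact f.span_eq
  induction hθ using Submodule.span_induction with
  | mem x hx =>
    obtain ⟨s, rfl⟩ := hx
    have key : ∀ g : Fin 3 ↪o Fin 4, exteriorPower.ιMulti ℝ 3 (f ∘ g) =
        exteriorPower.ιMulti ℝ 3 ![f (g 0), f (g 1), f (g 2)] := fun g => by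
      congr 1; exact eq_vec_three _
    -- The increasing triples in `Fin 4` are the four complements of a point.
    have cases : ∀ x y z : Fin 4, x < y → y < z → (x = 0 ∧ y = 1 ∧ z = 2) ∨
        (x = 0 ∧ y = 1 ∧ z = 3) ∨ (x = 0 ∧ y = 2 ∧ z = 3) ∨ (x = 1 ∧ y = 2 ∧ z = 3) := by decide
    have h : exteriorPower.ιMulti_family ℝ 3 f s =
      exteriorPower.ιMulti ℝ 3 (f ∘ (Set.powersetCard.ofFinEmbEquiv.symm s)) := rfl
    rw [h, key]
    generalize Set.powersetCard.ofFinEmbEquiv.symm s = g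
    have h01 : g 0 < g 1 := g.strictMono (by decide)
    have h12 : g 1 < g 2 := g.strictMono (by decide)
    rcases cases _ _ _ h01 h12 with ⟨hx, hy, hz⟩ | ⟨hx, hy, hz⟩ | ⟨hx, hy, hz⟩ | ⟨hx, hy, hz⟩
    · exact ⟨1, 0, 0, 0, by rw [hx, hy, hz]; module⟩
    · exact ⟨0, 1, 0, 0, by rw [hx, hy, hz]; module⟩
    · exact ⟨0, 0, 1, 0, by rw [hx, hy, hz]; module⟩
    · exact ⟨0, 0, 0, 1, by rw [hx, hy, hz]; module⟩
  | zero => exact ⟨0, 0, 0, 0, by module⟩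
  | add x y _ _ hx hy =>
    obtain ⟨a, b, c, d, hx⟩ := hx
    obtain ⟨a', b', c', d', hy⟩ := hy
    refine ⟨a + a', b + b', c + c', d + d', ?_⟩
    rw [hx, hy]
    module
  | smul r x _ hx =>
    obtain ⟨a, b, c, d, hx⟩ := hx
    refine ⟨r * a, r * b, r * c, r * d, ?_⟩
    rw [hx]
    module

/-- The one-form with given values on a basis. -/
def oneFormOfBasis {N : Type*} [AddCommGroup N] [Module ℝ N] (t : Module.Basis (Fin 3) ℝ T)
    (x : Fin 3 → N) : T [⋀^Fin 1]→ₗ[ℝ] N :=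
  AlternatingMap.ofSubsingleton ℝ T N (0 : Fin 1) (t.constr ℝ x)

theorem oneFormOfBasis_apply {N : Type*} [AddCommGroup N] [Module ℝ N]
    (t : Module.Basis (Fin 3) ℝ T) (x : Fin 3 → N) (i : Fin 3) :
    oneFormOfBasis t x ![t i] = x i := by
  simp [oneFormOfBasis]

theorem twoForm_ext {N : Type*} [AddCommGroup N] [Module ℝ N] (t : Module.Basis (Fin 3) ℝ T)
    {α β : T [⋀^Fin 2]→ₗ[ℝ] N} (h01 : α ![t 0, t 1] = β ![t 0, t 1])
    (h02 : α ![t 0, t 2] = β ![t 0, t 2]) (h12 : α ![t 1, t 2] = β ![t 1, t 2]) : α = β := by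
  refine Module.Basis.ext_alternating t fun v hv => ?_
  rw [eq_vec_two fun i => t (v i)]
  have hne : v 0 ≠ v 1 := fun h => absurd (hv h) (by decide)
  have s01 := alternating_swap α (t 0) (t 1)
  have s02 := alternating_swap α (t 0) (t 2)
  have s12 := alternating_swap α (t 1) (t 2)
  have r01 := alternating_swap β (t 0) (t 1)
  have r02 := alternating_swap β (t 0) (t 2)
  have r12 := alternating_swap β (t 1) (t 2)
  generalize v 0 = p at *
  generalize v 1 = q at *
  fin_cases p <;> fin_cases q <;> simp_all

theorem extMul_oneι_twoι (x y z : W) :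
    extMul 1 2 (exteriorPower.ιMulti ℝ 1 ![x]) (exteriorPower.ιMulti ℝ 2 ![y, z]) =
      exteriorPower.ιMulti ℝ 3 ![x, y, z] := by
  apply Subtype.ext
  refine (coe_extMul _ _).trans ?_
  simp [ExteriorAlgebra.ιMulti_apply]

theorem extMul_oneι_threeι (w x y z : W) :
    extMul 1 3 (exteriorPower.ιMulti ℝ 1 ![w]) (exteriorPower.ιMulti ℝ 3 ![x, y, z]) =
      exteriorPower.ιMulti ℝ 4 ![w, x, y, z] := by
  apply Subtype.ext
  refine (coe_extMul _ _).trans ?_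
  simp [ExteriorAlgebra.ιMulti_apply]

theorem exists_eq_oneι (x : ⋀[ℝ]^1 W) : ∃ w : W, x = exteriorPower.ιMulti ℝ 1 ![w] := by
  obtain ⟨w, hw⟩ := exists_coe_eq_ι x
  exact ⟨w, Subtype.ext (by simp [hw, ExteriorAlgebra.ιMulti_apply])⟩

/-- A linearly independent triple in a four-dimensional space is the initial part of a basis. -/
theorem exists_basis_extending (hW : Module.finrank ℝ W = 4) (w : Fin 3 → W)
    (hw : LinearIndependent ℝ w) :
    ∃ f : Module.Basis (Fin 4) ℝ W, f 0 = w 0 ∧ f 1 = w 1 ∧ f 2 = w 2 := by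
  have hfin : Module.Finite ℝ W := Module.finite_of_finrank_pos (by omega)
  have hne : ∃ x, x ∉ Submodule.span ℝ (Set.range w) := by
    by_contra! h
    have h1 : Submodule.span ℝ (Set.range w) = ⊤ := by ext x; simp [h x]
    have h2 := finrank_range_le_card (R := ℝ) w
    rw [Set.finrank, h1, finrank_top, hW] at h2
    simp at h2
  obtain ⟨x, hx⟩ := hne
  have hli : LinearIndependent ℝ (Fin.snoc w x : Fin 4 → W) := linearIndependent_finSnoc.2 ⟨hw, hx⟩
  refine ⟨basisOfLinearIndependentOfCardEqFinrank hli (by simp [hW]), ?_, ?_, ?_⟩ <;>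
    rw [coe_basisOfLinearIndependentOfCardEqFinrank] <;> rfl

/-- Wedging with an injective one-form `e` maps `T^* ⊗ ⋀²W` onto `⋀²T^* ⊗ ⋀³W`. -/
theorem fibreWedge_surjective (t : Module.Basis (Fin 3) ℝ T) (hW : Module.finrank ℝ W = 4)
    (e : T [⋀^Fin 1]→ₗ[ℝ] ⋀[ℝ]^1 W) (he : Function.Injective fun v : T => e fun _ => v)
    (Θ : T [⋀^Fin 2]→ₗ[ℝ] ⋀[ℝ]^3 W) :
    ∃ a : T [⋀^Fin 1]→ₗ[ℝ] ⋀[ℝ]^2 W, fibreWedge e a = Θ := by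
  -- `E` is `e` read as a linear map into `W` itself, so that injectivity turns the basis of `T`
  -- into an independent triple in `W`.
  let E : T →ₗ[ℝ] W := (exteriorPower.oneEquiv ℝ W).toLinearMap ∘ₗ
    (AlternatingMap.ofSubsingleton ℝ T (⋀[ℝ]^1 W) (0 : Fin 1)).symm e
  have hE : ∀ v, e ![v] = exteriorPower.ιMulti ℝ 1 ![E v] := fun v => by
    have h1 : (exteriorPower.oneEquiv ℝ W) (exteriorPower.ιMulti ℝ 1 ![E v]) = E v := by
      rw [exteriorPower.oneEquiv_ιMulti]; rfl
    apply (exteriorPower.oneEquiv ℝ W).injective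
    rw [h1]
    change _ = exteriorPower.oneEquiv ℝ W (e fun _ => v)
    congr 2
    funext n
    fin_cases n
    rfl
  have hEinj : Function.Injective E := fun u v h => he (by
    change e (fun _ => u) = e (fun _ => v)
    rw [eq_vec_one fun _ : Fin 1 => u, eq_vec_one fun _ : Fin 1 => v, hE, hE, h])
  obtain ⟨f, f0, f1, f2⟩ := exists_basis_extending hW (E ∘ t)
    (t.linearIndependent.map' E (LinearMap.ker_eq_bot.2 hEinj))
  simp only [Function.comp_apply] at f0 f1 f2
  obtain ⟨a01, b01, c01, d01, h01⟩ := exists_coe_three_eq f (Θ ![t 0, t 1])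
  obtain ⟨a02, b02, c02, d02, h02⟩ := exists_coe_three_eq f (Θ ![t 0, t 2])
  obtain ⟨a12, b12, c12, d12, h12⟩ := exists_coe_three_eq f (Θ ![t 1, t 2])
  -- The products of two and of three basis vectors become opaque symbols `w i j` and `z i j k`;
  -- from here on only the multiplication rule `hm`, the vanishing on repeated indices and the
  -- antisymmetry `hsw` are used.
  obtain ⟨w, hw⟩ : ∃ w : Fin 4 → Fin 4 → ⋀[ℝ]^2 W,
    w = fun i j => exteriorPower.ιMulti ℝ 2 ![f i, f j] := ⟨_, rfl⟩
  obtain ⟨z, hz⟩ : ∃ z : Fin 4 → Fin 4 → Fin 4 → ⋀[ℝ]^3 W,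
    z = fun i j k => exteriorPower.ιMulti ℝ 3 ![f i, f j, f k] := ⟨_, rfl⟩
  have hz' : ∀ i j k, exteriorPower.ιMulti ℝ 3 ![f i, f j, f k] = z i j k := fun i j k => by rw [hz]
  have hm : ∀ i j k, extMul 1 2 (exteriorPower.ιMulti ℝ 1 ![f i]) (w j k) = z i j k :=
    fun i j k => by rw [hw, hz]; exact extMul_oneι_twoι _ _ _
  have hz12 : ∀ i k, z i i k = 0 := fun i k => by
    rw [hz]
    exact (exteriorPower.ιMulti ℝ 3).map_eq_zero_of_eq _ (i := 0) (j := 1) rfl (by decide)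
  have hz13 : ∀ i j, z i j i = 0 := fun i k => by
    rw [hz]
    exact (exteriorPower.ιMulti ℝ 3).map_eq_zero_of_eq _ (i := 0) (j := 2) rfl (by decide)
  have hsw : ∀ i j k, z j i k = -z i j k := fun i j k => by
    rw [hz]
    refine Eq.trans ?_ ((exteriorPower.ιMulti ℝ 3).map_swap (v := ![f i, f j, f k]) (i := 0) (j := 1)
      (by decide))
    congr 1
  rw [hz', hz', hz', hz'] at h01 h02 h12
  -- With `a i` the value of the unknown at `t i`, the equations read `f j ∧ a i - f i ∧ a j = Θ (t
  -- i, t j)`. Every coefficient can be matched by one value separately, except those of `z 0 1 3`,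
  -- `z 0 2 3`, `z 1 2 3` in `Θ` at `(0,1)`, `(0,2)`, `(1,2)`. They couple the coefficients `p`,
  -- `q`, `r` of `w i 3` in `a i` by `p + q = -b01`, `p + r = -c02`, `q + r = -d12`, which these
  -- values solve.
  let p := -(b01 + c02 - d12) / 2
  let q := -(b01 + d12 - c02) / 2
  let r := -(c02 + d12 - b01) / 2
  refine ⟨oneFormOfBasis t ![d01 • w 2 3 - d02 • w 1 3 + p • w 0 3,
    (-a01) • w 1 2 - c01 • w 2 3 - c12 • w 0 3 + q • w 1 3,
    (-a02) • w 1 2 - b02 • w 1 3 + a12 • w 0 2 + b12 • w 0 3 + r • w 2 3], ?_⟩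
  have key : ∀ (i j : Fin 3) (x : Fin 3 → ⋀[ℝ]^2 W), fibreWedge e (oneFormOfBasis t x) ![t i, t j] =
      -(extMul 1 2 (exteriorPower.ιMulti ℝ 1 ![E (t i)]) (x j) -
        extMul 1 2 (exteriorPower.ιMulti ℝ 1 ![E (t j)]) (x i)) := by
    intro i j x
    rw [fibreWedge_one_one, pow_one, oneFormOfBasis_apply, oneFormOfBasis_apply, hE, hE]
    module
  refine twoForm_ext t ?_ ?_ ?_
  · refine (key 0 1 _).trans ?_
    rw [← f0, ← f1, h01]
    simp only [Matrix.cons_val, map_add, map_sub, map_smul, hm, hz12, hsw 0 1, p, q]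
    module
  · refine (key 0 2 _).trans ?_
    rw [← f0, ← f2, h02]
    simp only [Matrix.cons_val, map_add, map_sub, map_smul, hm, hz12, hsw 0 2, hsw 1 2, p, r]
    module
  · refine (key 1 2 _).trans ?_
    rw [← f1, ← f2, h12]
    simp only [Matrix.cons_val, map_add, map_sub, map_smul, hm, hz12, hz13, hsw 0 1, hsw 0 2,
      hsw 1 2, q, r]
    module

/-- A non-zero `w` has some non-zero coordinate `m`; putting it in place of `f m` multiplies the
volume by that coordinate, and a transposition brings it to the first slot. -/
theorem exists_eq_first_of_ne_zero (f : Module.Basis (Fin 4) ℝ W) (vol : W [⋀^Fin 4]→ₗ[ℝ] ℝ)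
    (hvol : vol f ≠ 0) (w : W) (hw : w ≠ 0) : ∃ x y z, vol ![w, x, y, z] ≠ 0 := by
  obtain ⟨m, hm⟩ : ∃ m, f.repr w m ≠ 0 := by
    by_contra! h
    exact hw (f.repr.map_eq_zero_iff.1 (Finsupp.ext h))
  have h1 : vol (Function.update f m w) = f.repr w m * vol f := by
    conv_lhs => rw [← f.sum_repr w]
    rw [vol.map_update_sum, Finset.sum_eq_single m]
    · rw [vol.map_update_smul, Function.update_eq_self, smul_eq_mul]
    · intro b _ hb
      rw [vol.map_update_smul, vol.map_update_self _ hb.symm, smul_zero]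
    · simp
  have h2 : vol (Function.update f m w ∘ Equiv.swap 0 m) ≠ 0 := by
    rw [AlternatingMap.map_perm, h1, Units.smul_def]
    refine smul_ne_zero (Units.ne_zero _) (mul_ne_zero hm hvol)
  rw [eq_vec_four (Function.update f m w ∘ Equiv.swap 0 m)] at h2
  refine ⟨_, _, _, by convert h2 using 3; simp⟩

/-- The volume form as a functional on the top exterior power, applied to a product. -/
theorem volume_extMul (vol : W [⋀^Fin 4]→ₗ[ℝ] ℝ) (w x y z : W) :
    exteriorPower.alternatingMapLinearEquiv vol (extMul 1 3 (exteriorPower.ιMulti ℝ 1 ![w])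
      (exteriorPower.ιMulti ℝ 3 ![x, y, z])) = vol ![w, x, y, z] := by
  rw [extMul_oneι_threeι]
  exact exteriorPower.alternatingMapLinearEquiv_apply_ιMulti _ _

/-- Multiplying by `f i` kills every basis triple that contains `f i`, so it isolates the
coefficient of the one triple omitting it. If all four products vanish, so do all four coefficients.
-/
theorem exists_extMul_ne_zero (f : Module.Basis (Fin 4) ℝ W) (vol : W [⋀^Fin 4]→ₗ[ℝ] ℝ)
    (hvol : vol f ≠ 0) (θ : ⋀[ℝ]^3 W) (hθ : θ ≠ 0) :
    ∃ y : ⋀[ℝ]^1 W, exteriorPower.alternatingMapLinearEquiv vol (extMul 1 3 y θ) ≠ 0 := by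
  obtain ⟨a, b, c, d, h⟩ := exists_coe_three_eq f θ
  by_contra! hc
  have hv : vol ![f 0, f 1, f 2, f 3] ≠ 0 := by rwa [← eq_vec_four]
  have key : ∀ i, a * vol ![f i, f 0, f 1, f 2] + b * vol ![f i, f 0, f 1, f 3] +
      c * vol ![f i, f 0, f 2, f 3] + d * vol ![f i, f 1, f 2, f 3] = 0 := by
    intro i
    have h1 := hc (exteriorPower.ιMulti ℝ 1 ![f i])
    rw [h] at h1
    simpa only [map_add, map_smul, volume_extMul, smul_eq_mul] using h1
  have rep : ∀ g : Fin 4 → Fin 4, (¬ Function.Injective g) →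
      vol ![f (g 0), f (g 1), f (g 2), f (g 3)] = 0 := by
    intro g hg
    rw [← eq_vec_four fun i => f (g i)]
    exact vol.map_eq_zero_of_not_injective _ fun h => hg fun i j hij => h (by simp [hij])
  have perm : ∀ σ : Equiv.Perm (Fin 4), vol ![f (σ 0), f (σ 1), f (σ 2), f (σ 3)] ≠ 0 := by
    intro σ
    rw [← eq_vec_four fun i => f (σ i)]
    have := AlternatingMap.map_perm vol f σ
    change vol (f ∘ σ) ≠ 0
    rw [this, Units.smul_def]
    exact smul_ne_zero (Units.ne_zero _) hvol
  have r : ∀ p q r s : Fin 4, (¬ Function.Injective ![p, q, r, s]) →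
      vol ![f p, f q, f r, f s] = 0 := fun p q r s hg => rep _ hg
  have pp : ∀ p q r s : Fin 4, (Function.Bijective ![p, q, r, s]) →
      vol ![f p, f q, f r, f s] ≠ 0 := fun p q r s hg => perm (Equiv.ofBijective _ hg)
  have k0 := key 0
  have k1 := key 1
  have k2 := key 2
  have k3 := key 3
  rw [r 0 0 1 2 (by decide), r 0 0 1 3 (by decide), r 0 0 2 3 (by decide)] at k0
  rw [r 1 0 1 2 (by decide), r 1 0 1 3 (by decide), r 1 1 2 3 (by decide)] at k1
  rw [r 2 0 1 2 (by decide), r 2 0 2 3 (by decide), r 2 1 2 3 (by decide)] at k2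
  rw [r 3 0 1 3 (by decide), r 3 0 2 3 (by decide), r 3 1 2 3 (by decide)] at k3
  have d0 : d = 0 := by simpa [pp 0 1 2 3 (by decide)] using k0
  have c0 : c = 0 := by simpa [pp 1 0 2 3 (by decide)] using k1
  have b0 : b = 0 := by simpa [pp 2 0 1 3 (by decide)] using k2
  have a0 : a = 0 := by simpa [pp 3 0 1 2 (by decide)] using k3
  apply hθ
  rw [h, a0, b0, c0, d0]
  module

/-- The wedge pairing of `⋀²T^* ⊗ ⋀³W` with `T^* ⊗ W` is non-degenerate. -/
theorem exists_wedge_twoForm_ne_zero (t : Module.Basis (Fin 3) ℝ T) (f : Module.Basis (Fin 4) ℝ W)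
    (vol : W [⋀^Fin 4]→ₗ[ℝ] ℝ) (hvol : vol f ≠ 0) (Θ : T [⋀^Fin 2]→ₗ[ℝ] ⋀[ℝ]^3 W) (hΘ : Θ ≠ 0) :
    ∃ b : T [⋀^Fin 1]→ₗ[ℝ] ⋀[ℝ]^1 W,
      exteriorPower.alternatingMapLinearEquiv vol (fibreWedge b Θ ![t 0, t 1, t 2]) ≠ 0 := by
  have key : ∀ y : Fin 3 → ⋀[ℝ]^1 W, fibreWedge (oneFormOfBasis t y) Θ ![t 0, t 1, t 2] =
      extMul 1 3 (y 0) (Θ ![t 1, t 2]) - extMul 1 3 (y 1) (Θ ![t 0, t 2]) +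
        extMul 1 3 (y 2) (Θ ![t 0, t 1]) := by
    intro y
    rw [fibreWedge_one_two]
    simp only [oneFormOfBasis_apply]
  -- If `Θ` is non-zero on a pair of basis vectors, a one-form supported on the remaining basis
  -- vector selects exactly that term of `key`.
  by_cases h12 : Θ ![t 1, t 2] = 0
  · by_cases h02 : Θ ![t 0, t 2] = 0
    · by_cases h01 : Θ ![t 0, t 1] = 0
      · exact absurd (twoForm_ext t (β := 0) h01 h02 h12) hΘ
      · obtain ⟨y, hy⟩ := exists_extMul_ne_zero f vol hvol _ h01
        refine ⟨oneFormOfBasis t ![0, 0, y], ?_⟩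
        rw [key]
        simpa using hy
    · obtain ⟨y, hy⟩ := exists_extMul_ne_zero f vol hvol _ h02
      refine ⟨oneFormOfBasis t ![0, y, 0], ?_⟩
      rw [key]
      simpa using hy
  · obtain ⟨y, hy⟩ := exists_extMul_ne_zero f vol hvol _ h12
    refine ⟨oneFormOfBasis t ![y, 0, 0], ?_⟩
    rw [key]
    simpa using hy

/-- If `b` takes a non-zero value `w` on `t i`, then `w` completes to a product `w ∧ x ∧ y ∧ z` of
non-zero volume. The partner is built as a product of two one-forms, with values `x` and `y ∧ z` on
the other two basis vectors, so that only the term with `b (t i)` survives. -/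
theorem exists_wedge_oneForm_ne_zero (t : Module.Basis (Fin 3) ℝ T) (f : Module.Basis (Fin 4) ℝ W)
    (vol : W [⋀^Fin 4]→ₗ[ℝ] ℝ) (hvol : vol f ≠ 0) (b : T [⋀^Fin 1]→ₗ[ℝ] ⋀[ℝ]^1 W) (hb : b ≠ 0) :
    ∃ Θ : T [⋀^Fin 2]→ₗ[ℝ] ⋀[ℝ]^3 W,
      exteriorPower.alternatingMapLinearEquiv vol (fibreWedge b Θ ![t 0, t 1, t 2]) ≠ 0 := by
  obtain ⟨i, hi⟩ : ∃ i, b ![t i] ≠ 0 := by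
    by_contra! h
    refine hb (Module.Basis.ext_alternating t fun v _ => ?_)
    rw [eq_vec_one fun i => t (v i)]
    exact h _
  obtain ⟨w, hw⟩ := exists_eq_oneι (b ![t i])
  have hw0 : w ≠ 0 := by
    rintro rfl
    apply hi
    rw [hw]
    exact (exteriorPower.ιMulti ℝ 1).map_coord_zero 0 rfl
  obtain ⟨x, y, z, h⟩ := exists_eq_first_of_ne_zero f vol hvol w hw0
  rw [← volume_extMul, ← hw, ← extMul_oneι_twoι] at h
  generalize exteriorPower.ιMulti ℝ 1 ![x] = p at h
  generalize exteriorPower.ιMulti ℝ 2 ![y, z] = q at h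
  have key : ∀ (u : Fin 3 → ⋀[ℝ]^1 W) (v : Fin 3 → ⋀[ℝ]^2 W) (j k : Fin 3),
      fibreWedge (oneFormOfBasis t u) (oneFormOfBasis t v) ![t j, t k] =
        -(extMul 1 2 (u j) (v k) - extMul 1 2 (u k) (v j)) := by
    intro u v j k
    rw [fibreWedge_one_one, pow_one, oneFormOfBasis_apply, oneFormOfBasis_apply,
      oneFormOfBasis_apply, oneFormOfBasis_apply]
    module
  have main : ∀ (u : Fin 3 → ⋀[ℝ]^1 W) (v : Fin 3 → ⋀[ℝ]^2 W), fibreWedge b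
      (fibreWedge (oneFormOfBasis t u) (oneFormOfBasis t v)) ![t 0, t 1, t 2] =
      -extMul 1 3 (b ![t 0]) (extMul 1 2 (u 1) (v 2) - extMul 1 2 (u 2) (v 1))
      + extMul 1 3 (b ![t 1]) (extMul 1 2 (u 0) (v 2) - extMul 1 2 (u 2) (v 0))
      - extMul 1 3 (b ![t 2]) (extMul 1 2 (u 0) (v 1) - extMul 1 2 (u 1) (v 0)) := by
    intro u v
    rw [fibreWedge_one_two, key, key, key, map_neg, map_neg, map_neg]
    abel
  have hi3 : i = 0 ∨ i = 1 ∨ i = 2 := by fin_cases i <;> simp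
  rcases hi3 with rfl | rfl | rfl
  · refine ⟨fibreWedge (oneFormOfBasis t ![0, p, 0]) (oneFormOfBasis t ![0, 0, q]), ?_⟩
    rw [main]
    simpa using h
  · refine ⟨fibreWedge (oneFormOfBasis t ![p, 0, 0]) (oneFormOfBasis t ![0, 0, q]), ?_⟩
    rw [main]
    simpa using h
  · refine ⟨fibreWedge (oneFormOfBasis t ![p, 0, 0]) (oneFormOfBasis t ![0, q, 0]), ?_⟩
    rw [main]
    simpa using h

end FibreAlgebra

/-! ### Smoothness of multilinear expressions, and functionals on the model fibre -/

section MultilinearSmooth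

variable {S : Type*} [TopologicalSpace S] [ChartedSpace E3 S]
  {E : Type*} [NormedAddCommGroup E] [NormedSpace ℝ E] [FiniteDimensional ℝ E]

theorem contMDiffOn_linear_comp (l : E →ₗ[ℝ] ℝ) {f : S → E} {U : Set S}
    (hf : ContMDiffOn (𝓡 3) 𝓘(ℝ, E) ∞ f U) :
    ContMDiffOn (𝓡 3) 𝓘(ℝ) ∞ (fun x => l (f x)) U :=
  (LinearMap.toContinuousLinearMap l).contMDiff.comp_contMDiffOn hf

theorem multilinear_expand {n : ℕ} {N : Type*} [AddCommGroup N] [Module ℝ N]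
    (m : MultilinearMap ℝ (fun _ : Fin n => E) N) (w : Fin n → E) :
    m w = ∑ r : Fin n → Fin (Module.finrank ℝ E),
      (∏ k, (Module.finBasis ℝ E).repr (w k) (r k)) • m fun k => Module.finBasis ℝ E (r k) := by
  conv_lhs => rw [show w = fun k => ∑ c, (Module.finBasis ℝ E).repr (w k) c • Module.finBasis ℝ E c
    from funext fun k => ((Module.finBasis ℝ E).sum_repr (w k)).symm]
  rw [m.map_sum]
  refine Finset.sum_congr rfl fun r _ => ?_
  rw [m.map_smul_univ]

theorem contMDiffOn_multilinear {n : ℕ} (m : MultilinearMap ℝ (fun _ : Fin n => E) ℝ)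
    {f : Fin n → S → E} {U : Set S} (hf : ∀ k, ContMDiffOn (𝓡 3) 𝓘(ℝ, E) ∞ (f k) U) :
    ContMDiffOn (𝓡 3) 𝓘(ℝ) ∞ (fun x => m fun k => f k x) U := by
  refine ContMDiffOn.congr ?_ fun x _ => multilinear_expand m fun k => f k x
  refine contMDiffOn_finsetSum fun r _ => ContMDiffOn.mul ?_ contMDiffOn_const
  exact contMDiffOn_finsetProd fun k _ =>
    contMDiffOn_linear_comp ((Module.finBasis ℝ E).coord (r k)) (hf k)

end MultilinearSmooth

instance alternatingMap_finite {M N : Type*} [AddCommGroup M] [Module ℝ M] [Module.Finite ℝ M]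
    [AddCommGroup N] [Module ℝ N] [Module.Finite ℝ N] {i : ℕ} :
    Module.Finite ℝ (M [⋀^Fin i]→ₗ[ℝ] N) :=
  Module.Finite.of_injective
    ({ toFun := fun a => a.toMultilinearMap
       map_add' := fun _ _ => rfl
       map_smul' := fun _ _ => rfl } : (M [⋀^Fin i]→ₗ[ℝ] N) →ₗ[ℝ] MultilinearMap ℝ _ N)
    AlternatingMap.coe_multilinearMap_injective

/-- The model of the fibre of `Λ^i T^*S ⊗ ⋀^j V`. -/
abbrev ModelForm (i j : ℕ) : Type := E3 [⋀^Fin i]→ₗ[ℝ] ⋀[ℝ]^j F4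

instance modelForm_free (i j : ℕ) : Module.Free ℝ (ModelForm i j) :=
  Module.Free.of_divisionRing ℝ (ModelForm i j)

/-- Evaluation of a model form on vectors, followed by a functional. -/
def evalDual {i j : ℕ} (v : Fin i → E3) (l : Module.Dual ℝ (⋀[ℝ]^j F4)) :
    Module.Dual ℝ (ModelForm i j) where
  toFun a := l (a v)
  map_add' a b := by simp
  map_smul' c a := by simp

/-- Evaluations span the dual of the space of model forms. -/
theorem dual_induction {i j : ℕ} {P : Module.Dual ℝ (ModelForm i j) → Prop}
    (eval : ∀ v l, P (evalDual v l)) (zero : P 0) (add : ∀ φ ψ, P φ → P ψ → P (φ + ψ))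
    (smul : ∀ (c : ℝ) φ, P φ → P (c • φ)) (φ : Module.Dual ℝ (ModelForm i j)) : P φ := by
  let s : Set (Module.Dual ℝ (ModelForm i j)) := Set.range fun p : (Fin i → E3) × _ =>
    evalDual p.1 p.2
  have hs : Submodule.span ℝ s = ⊤ := by
    have h0 : Module.Finite ℝ (Module.Dual ℝ (ModelForm i j)) :=
      Module.Finite.linearMap ℝ ℝ (ModelForm i j) ℝ
    have h1 : FiniteDimensional ℝ (Submodule.span ℝ s) :=
      Module.Finite.of_injective (Submodule.span ℝ s).subtype (Submodule.injective_subtype _)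
    have hd : (Submodule.span ℝ s).dualCoannihilator.dualAnnihilator = Submodule.span ℝ s :=
      Subspace.dualCoannihilator_dualAnnihilator_eq (K := ℝ) (V := ModelForm i j)
    rw [← hd]
    -- Evaluations separate the model forms, so nothing non-zero is annihilated by their span; in
    -- finite dimension the span is then the whole dual.
    have : (Submodule.span ℝ s).dualCoannihilator = ⊥ := by
      rw [eq_bot_iff]
      intro a ha
      rw [Submodule.mem_dualCoannihilator] at ha
      rw [Submodule.mem_bot]
      ext1 v
      exact (Module.forall_dual_apply_eq_zero_iff ℝ _).1 fun l =>
        ha _ (Submodule.subset_span ⟨(v, l), rfl⟩)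
    rw [this, Submodule.dualAnnihilator_bot]
  have hφ : φ ∈ Submodule.span ℝ s := hs ▸ Submodule.mem_top
  induction hφ using Submodule.span_induction with
  | mem x hx => obtain ⟨p, rfl⟩ := hx; exact eval _ _
  | zero => exact zero
  | add x y _ _ hx hy => exact add x y hx hy
  | smul c x _ hx => exact smul c x hx

/-! ### Transition functions of a smooth vector bundle -/

section Transition

variable {S : Type*} [TopologicalSpace S] [ChartedSpace E3 S]
  {F : Type*} [NormedAddCommGroup F] [NormedSpace ℝ F]
  (V : S → Type*) [TopologicalSpace (TotalSpace F V)] [∀ x, AddCommGroup (V x)]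
  [∀ x, Module ℝ (V x)] [∀ x, TopologicalSpace (V x)] [FiberBundle F V] [VectorBundle ℝ F V]
  [ContMDiffVectorBundle ∞ F V (𝓡 3)]

theorem contMDiffOn_transition (x₀ x₁ : S) (w : F) :
    ContMDiffOn (𝓡 3) 𝓘(ℝ, F) ∞ (fun x => (trivializationAt F V x₁).linearMapAt ℝ x
      ((trivializationAt F V x₀).symmₗ ℝ x w))
      ((trivializationAt F V x₀).baseSet ∩ (trivializationAt F V x₁).baseSet) := by
  have h := (contMDiffOn_coordChangeL (IB := 𝓡 3) (n := ∞) (trivializationAt F V x₀)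
    (trivializationAt F V x₁)).clm_apply (contMDiffOn_const (c := w))
  refine h.congr fun x hx => ?_
  rw [Trivialization.coe_linearMapAt_of_mem _ hx.2, Trivialization.symmₗ_apply _ hx.1]
  exact (Trivialization.coordChangeL_apply _ _ hx w).symm

end Transition

/-! ### Local representatives of forms, and forms with prescribed values -/

section LocalRepresentation

variable {S : Type*} [TopologicalSpace S] [ChartedSpace E3 S] [IsManifold (𝓡 3) ∞ S]
  {V : S → Type*} [TopologicalSpace (TotalSpace F4 V)] [∀ x, AddCommGroup (V x)]
  [∀ x, Module ℝ (V x)] [∀ x, TopologicalSpace (V x)] [FiberBundle F4 V] [VectorBundle ℝ F4 V]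

theorem isOpen_nbhd (x₀ : S) : IsOpen (nbhd V x₀) :=
  (chartAt E3 x₀).open_source.inter (trivializationAt F4 V x₀).open_baseSet

theorem mem_nbhd_self (x₀ : S) : x₀ ∈ nbhd V x₀ :=
  ⟨mem_chart_source E3 x₀, FiberBundle.mem_baseSet_trivializationAt' x₀⟩

theorem mem_tangent_baseSet {x₀ x : S} (hx : x ∈ (chartAt E3 x₀).source) :
    x ∈ (trivializationAt E3 (TangentSpace (𝓡 3) : S → Type _) x₀).baseSet := by
  rwa [TangentBundle.trivializationAt_baseSet]

/-- The model form representing an element of the fibre at `x` in the chart and trivialization at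
`x₀`. -/
def localRep {i j : ℕ} (x₀ x : S) :
    ((TangentSpace (𝓡 3) x) [⋀^Fin i]→ₗ[ℝ] ⋀[ℝ]^j (V x)) →ₗ[ℝ] ModelForm i j where
  toFun α := (exteriorPower.map j ((trivializationAt F4 V x₀).linearMapAt ℝ x)).compAlternatingMap
    (α.compLinearMap ((trivializationAt E3 (TangentSpace (𝓡 3) : S → Type _) x₀).symmₗ ℝ x))
  map_add' α β := by ext1 v; simp
  map_smul' c α := by ext1 v; simp

/-- The element of the fibre at `x` represented by a model form. -/
def localLift {i j : ℕ} (x₀ x : S) :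
    ModelForm i j →ₗ[ℝ] ((TangentSpace (𝓡 3) x) [⋀^Fin i]→ₗ[ℝ] ⋀[ℝ]^j (V x)) where
  toFun a := (exteriorPower.map j ((trivializationAt F4 V x₀).symmₗ ℝ x)).compAlternatingMap
    (a.compLinearMap
      ((trivializationAt E3 (TangentSpace (𝓡 3) : S → Type _) x₀).linearMapAt ℝ x))
  map_add' α β := by ext1 v; simp
  map_smul' c α := by ext1 v; simp

theorem localRep_apply {i j : ℕ} (x₀ x : S)
    (α : (TangentSpace (𝓡 3) x) [⋀^Fin i]→ₗ[ℝ] ⋀[ℝ]^j (V x)) (v : Fin i → E3) :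
    localRep x₀ x α v = exteriorPower.map j ((trivializationAt F4 V x₀).linearMapAt ℝ x)
      (α fun n => coordVec x₀ x (v n)) := rfl

theorem localLift_apply {i j : ℕ} (x₀ x : S) (a : ModelForm i j)
    (v : Fin i → TangentSpace (𝓡 3) x) :
    (localLift x₀ x a : (TangentSpace (𝓡 3) x) [⋀^Fin i]→ₗ[ℝ] ⋀[ℝ]^j (V x)) v =
      exteriorPower.map j ((trivializationAt F4 V x₀).symmₗ ℝ x) (a fun n =>
        (trivializationAt E3 (TangentSpace (𝓡 3) : S → Type _) x₀).linearMapAt ℝ x (v n)) := rfl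

theorem component_eq {i j : ℕ} (α : RoughForm V i j) (x₀ : S) (v : Fin i → E3)
    (l : Module.Dual ℝ (⋀[ℝ]^j F4)) (x : S) :
    component α x₀ v l x = evalDual v l (localRep x₀ x (α x)) := rfl

theorem localLift_localRep {i j : ℕ} {x₀ x : S} (hx : x ∈ nbhd V x₀)
    (α : (TangentSpace (𝓡 3) x) [⋀^Fin i]→ₗ[ℝ] ⋀[ℝ]^j (V x)) :
    localLift x₀ x (localRep x₀ x α) = α := by
  ext1 v
  rw [localLift_apply, localRep_apply, ← LinearMap.comp_apply, ← exteriorPower.map_comp]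
  have h1 : (trivializationAt F4 V x₀).symmₗ ℝ x ∘ₗ (trivializationAt F4 V x₀).linearMapAt ℝ x =
      LinearMap.id := LinearMap.ext fun w => Trivialization.symmₗ_linearMapAt _ hx.2 w
  rw [h1, exteriorPower.map_id]
  refine congrArg α (funext fun n => ?_)
  exact Trivialization.symmₗ_linearMapAt _ (mem_tangent_baseSet hx.1) (v n)

theorem localRep_localLift {i j : ℕ} {x₀ x : S} (hx : x ∈ nbhd V x₀) (a : ModelForm i j) :
    localRep x₀ x (localLift x₀ x a :
      (TangentSpace (𝓡 3) x) [⋀^Fin i]→ₗ[ℝ] ⋀[ℝ]^j (V x)) = a := by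
  ext1 v
  rw [localRep_apply, localLift_apply, ← LinearMap.comp_apply, ← exteriorPower.map_comp]
  have h1 : (trivializationAt F4 V x₀).linearMapAt ℝ x ∘ₗ (trivializationAt F4 V x₀).symmₗ ℝ x =
      LinearMap.id := LinearMap.ext fun w => Trivialization.linearMapAt_symmₗ _ hx.2 w
  rw [h1, exteriorPower.map_id]
  refine congrArg a (funext fun n => ?_)
  exact Trivialization.linearMapAt_symmₗ _ (mem_tangent_baseSet hx.1) (v n)

theorem localRep_injective {i j : ℕ} {x₀ x : S} (hx : x ∈ nbhd V x₀) :
    Function.Injective (localRep x₀ x :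
      ((TangentSpace (𝓡 3) x) [⋀^Fin i]→ₗ[ℝ] ⋀[ℝ]^j (V x)) →ₗ[ℝ] ModelForm i j) :=
  Function.LeftInverse.injective fun α => localLift_localRep hx α

/-- All functionals of the local representative of a smooth form are smooth. -/
theorem Form.contMDiffOn_dual {i j : ℕ} (α : Form V i j) (x₀ : S)
    (φ : Module.Dual ℝ (ModelForm i j)) :
    ContMDiffOn (𝓡 3) 𝓘(ℝ) ∞ (fun x => φ (localRep x₀ x (α.val x))) (nbhd V x₀) := by
  induction φ using dual_induction with
  | eval v l => exact α.smooth x₀ v l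
  | zero => exact contMDiffOn_const
  | add φ ψ h1 h2 => exact h1.add h2
  | smul c φ h => exact contMDiffOn_const.mul h

section Smooth

variable [ContMDiffVectorBundle ∞ F4 V (𝓡 3)]

/-- On a decomposable element the induced map acts factor by factor, giving a multilinear expression
in smooth functions; decomposable elements span. -/
theorem contMDiffOn_map_transition {j : ℕ} (x₀ x₁ : S) (l : Module.Dual ℝ (⋀[ℝ]^j F4))
    (u : ⋀[ℝ]^j F4) :
    ContMDiffOn (𝓡 3) 𝓘(ℝ) ∞ (fun x =>
      l (exteriorPower.map j ((trivializationAt F4 V x₁).linearMapAt ℝ x)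
        (exteriorPower.map j ((trivializationAt F4 V x₀).symmₗ ℝ x) u)))
      ((trivializationAt F4 V x₀).baseSet ∩ (trivializationAt F4 V x₁).baseSet) := by
  have hu : u ∈ Submodule.span ℝ (Set.range (exteriorPower.ιMulti ℝ j (M := F4))) := by
    rw [exteriorPower.ιMulti_span]; trivial
  induction hu using Submodule.span_induction with
  | mem x hx =>
    obtain ⟨w, rfl⟩ := hx
    simp only [exteriorPower.map_apply_ιMulti]
    exact contMDiffOn_multilinear
      ((l.compAlternatingMap (exteriorPower.ιMulti ℝ j (M := F4))).toMultilinearMap)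
      fun k => contMDiffOn_transition V x₀ x₁ (w k)
  | zero => simpa using contMDiffOn_const
  | add x y _ _ hx hy =>
    simp only [map_add]
    exact hx.add hy
  | smul c x _ hx =>
    simp only [map_smul, smul_eq_mul]
    exact contMDiffOn_const.mul hx

theorem contMDiffOn_localRep_localLift {i j : ℕ} (x₀ x₁ : S) (a : ModelForm i j)
    (φ : Module.Dual ℝ (ModelForm i j)) :
    ContMDiffOn (𝓡 3) 𝓘(ℝ) ∞ (fun x => φ (localRep x₁ x (localLift x₀ x a :
      (TangentSpace (𝓡 3) x) [⋀^Fin i]→ₗ[ℝ] ⋀[ℝ]^j (V x)))) (nbhd V x₀ ∩ nbhd V x₁) := by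
  induction φ using dual_induction with
  | eval v l =>
    -- Expanding the transported tangent vectors in a fixed basis separates the transition functions
    -- of the tangent bundle from those of `V`.
    refine ContMDiffOn.congr (f := fun x => ∑ r : Fin i → Fin (Module.finrank ℝ E3),
      (∏ k, (Module.finBasis ℝ E3).repr
        ((trivializationAt E3 (TangentSpace (𝓡 3) : S → Type _) x₀).linearMapAt ℝ x
          ((trivializationAt E3 (TangentSpace (𝓡 3) : S → Type _) x₁).symmₗ ℝ x (v k))) (r k)) *
      l (exteriorPower.map j ((trivializationAt F4 V x₁).linearMapAt ℝ x)
        (exteriorPower.map j ((trivializationAt F4 V x₀).symmₗ ℝ x)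
          (a fun k => Module.finBasis ℝ E3 (r k))))) ?_ fun x _ => ?_
    · refine contMDiffOn_finsetSum fun r _ => ContMDiffOn.mul ?_ ?_
      · refine contMDiffOn_finsetProd fun k _ =>
          contMDiffOn_linear_comp ((Module.finBasis ℝ E3).coord (r k))
            ((contMDiffOn_transition (TangentSpace (𝓡 3) : S → Type _) x₁ x₀ (v k)).mono ?_)
        exact fun x hx => ⟨mem_tangent_baseSet hx.2.1, mem_tangent_baseSet hx.1.1⟩
      · exact (contMDiffOn_map_transition x₀ x₁ l _).mono fun x hx => ⟨hx.1.2, hx.2.2⟩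
    · change l (exteriorPower.map j ((trivializationAt F4 V x₁).linearMapAt ℝ x)
        (exteriorPower.map j ((trivializationAt F4 V x₀).symmₗ ℝ x) (a.toMultilinearMap fun n =>
          (trivializationAt E3 (TangentSpace (𝓡 3) : S → Type _) x₀).linearMapAt ℝ x
          ((trivializationAt E3 (TangentSpace (𝓡 3) : S → Type _) x₁).symmₗ ℝ x (v n))))) = _
      rw [multilinear_expand]
      simp only [map_sum, map_smul, smul_eq_mul]
      rfl
  | zero => exact contMDiffOn_const
  | add φ ψ h1 h2 => exact h1.add h2
  | smul c φ h => exact contMDiffOn_const.mul h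

/-- A model form, transported to the fibres near `x₀` and multiplied by a cut-off function. -/
def cutoffForm {i j : ℕ} (x₀ : S) (f : S → ℝ) (hf : ContMDiff (𝓡 3) 𝓘(ℝ) ∞ f)
    (hs : tsupport f ⊆ nbhd V x₀) (a : ModelForm i j) : Form V i j where
  val x := f x • localLift x₀ x a
  smooth x₁ v l := by
    intro x hx
    have e : ∀ y, component (V := V) (fun x => f x • localLift x₀ x a) x₁ v l y =
        f y * evalDual v l (localRep x₁ y (localLift x₀ y a)) := fun y => by
      rw [component_eq, map_smul, map_smul, smul_eq_mul]
    -- On the closed support the local lift is defined and smooth; off it the form vanishes in a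
    -- neighbourhood.
    by_cases hxs : x ∈ tsupport f
    · have h1 := (contMDiffOn_localRep_localLift (V := V) x₀ x₁ a (evalDual v l)).contMDiffAt
        (((isOpen_nbhd x₀).inter (isOpen_nbhd x₁)).mem_nhds ⟨hs hxs, hx⟩)
      refine ContMDiffAt.contMDiffWithinAt ?_
      exact (hf.contMDiffAt.mul h1).congr_of_eventuallyEq (Filter.Eventually.of_forall e)
    · refine ContMDiffAt.contMDiffWithinAt ?_
      refine (contMDiffAt_const (c := (0 : ℝ))).congr_of_eventuallyEq ?_
      filter_upwards [notMem_tsupport_iff_eventuallyEq.1 hxs] with y hy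
      rw [e, hy, Pi.zero_apply, zero_mul]

end Smooth

/-- The product of a form with a smooth function. -/
def functionSmul {i j : ℕ} (f : S → ℝ) (hf : ContMDiff (𝓡 3) 𝓘(ℝ) ∞ f) (α : Form V i j) :
    Form V i j where
  val x := f x • α.val x
  smooth x₀ v l := by
    refine (hf.contMDiffOn.mul (α.smooth x₀ v l)).congr fun x _ => ?_
    rw [component_eq, map_smul, map_smul]
    rfl

end LocalRepresentation

/-! ### Families with all derivatives uniformly small on compact sets -/

section UniformlySmall

variable {ι : Type*} {𝓁 : Filter ι} {Ω : Set E3}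

/-- A family of functions all of whose derivatives tend to zero uniformly on the compact subsets of
`Ω`. -/
def UniformlySmall (𝓁 : Filter ι) (Ω : Set E3) (h : ι → E3 → ℝ) : Prop :=
  ∀ (k : ℕ) (K : Set E3), IsCompact K → K ⊆ Ω → ∀ ε > 0, ∀ᶠ a in 𝓁, ∀ y ∈ K,
    ‖iteratedFDerivWithin ℝ k (h a) Ω y‖ < ε

theorem UniformlySmall.congr {h h' : ι → E3 → ℝ} (hh : UniformlySmall 𝓁 Ω h)
    (e : ∀ a, Set.EqOn (h' a) (h a) Ω) : UniformlySmall 𝓁 Ω h' := by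
  intro k K hK hKΩ ε hε
  filter_upwards [hh k K hK hKΩ ε hε] with a ha y hy
  rw [iteratedFDerivWithin_congr (e a) (hKΩ hy)]
  exact ha y hy

theorem uniformlySmall_zero : UniformlySmall 𝓁 Ω fun _ _ => (0 : ℝ) := by
  intro k K _ _ ε hε
  refine Filter.Eventually.of_forall fun a y _ => ?_
  have : iteratedFDerivWithin ℝ k (fun _ : E3 => (0 : ℝ)) Ω = 0 := iteratedFDerivWithin_fun_zero
  rw [this]
  simpa using hε

theorem UniformlySmall.add (hΩ : IsOpen Ω) {h h' : ι → E3 → ℝ} (hh : UniformlySmall 𝓁 Ω h)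
    (hh' : UniformlySmall 𝓁 Ω h') (hs : ∀ a, ContDiffOn ℝ ∞ (h a) Ω)
    (hs' : ∀ a, ContDiffOn ℝ ∞ (h' a) Ω) : UniformlySmall 𝓁 Ω fun a y => h a y + h' a y := by
  intro k K hK hKΩ ε hε
  filter_upwards [hh k K hK hKΩ (ε / 2) (by positivity),
    hh' k K hK hKΩ (ε / 2) (by positivity)] with a h1 h2 y hy
  have hk : (k : WithTop ℕ∞) ≤ ∞ := by exact_mod_cast le_top
  have e := iteratedFDerivWithin_add_apply (((hs a) y (hKΩ hy)).of_le hk)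
    (((hs' a) y (hKΩ hy)).of_le hk) hΩ.uniqueDiffOn (hKΩ hy)
  change ‖iteratedFDerivWithin ℝ k (h a + h' a) Ω y‖ < ε
  rw [e]
  have := norm_add_le (iteratedFDerivWithin ℝ k (h a) Ω y) (iteratedFDerivWithin ℝ k (h' a) Ω y)
  linarith [h1 y hy, h2 y hy]

theorem UniformlySmall.mul (hΩ : IsOpen Ω) {g : E3 → ℝ} {h : ι → E3 → ℝ}
    (hg : ContDiffOn ℝ ∞ g Ω) (hh : UniformlySmall 𝓁 Ω h) (hs : ∀ a, ContDiffOn ℝ ∞ (h a) Ω) :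
    UniformlySmall 𝓁 Ω fun a y => g y * h a y := by
  intro k K hK hKΩ ε hε
  have hk : ∀ k : ℕ, (k : WithTop ℕ∞) ≤ ∞ := fun k => by exact_mod_cast le_top
  have hb : ∀ i, ∃ M : ℝ, ∀ y ∈ K, ‖iteratedFDerivWithin ℝ i g Ω y‖ ≤ M := fun i =>
    hK.exists_bound_of_continuousOn
      ((hg.continuousOn_iteratedFDerivWithin (hk i) hΩ.uniqueDiffOn).mono hKΩ)
  choose M hM using hb
  -- One constant bounds all derivatives of `g` up to order `k` on `K`; the summand `1` keeps it
  -- positive for the division below.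
  obtain ⟨C, hC0, hC⟩ : ∃ C : ℝ, 0 < C ∧ ∀ i ∈ Finset.range (k + 1), M i ≤ C := by
    refine ⟨1 + ∑ i ∈ Finset.range (k + 1), |M i|, ?_, fun i hi => ?_⟩
    · have : 0 ≤ ∑ i ∈ Finset.range (k + 1), |M i| := Finset.sum_nonneg fun i _ => abs_nonneg _
      linarith
    · have := Finset.single_le_sum (f := fun i => |M i|) (fun i _ => abs_nonneg _) hi
      have := le_abs_self (M i)
      linarith
  -- The binomial coefficients in the Leibniz bound add up to `2 ^ k`, which fixes the tolerance.
  have hev : ∀ᶠ a in 𝓁, ∀ i ∈ Finset.range (k + 1), ∀ y ∈ K,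
      ‖iteratedFDerivWithin ℝ (k - i) (h a) Ω y‖ < ε / (2 ^ k * C) :=
    (Filter.eventually_all_finset _).2 fun i _ => hh (k - i) K hK hKΩ _ (by positivity)
  filter_upwards [hev] with a ha y hy
  refine (norm_iteratedFDerivWithin_mul_le hg (hs a) hΩ.uniqueDiffOn (hKΩ hy) (hk k)).trans_lt ?_
  calc ∑ i ∈ Finset.range (k + 1), (k.choose i : ℝ) * ‖iteratedFDerivWithin ℝ i g Ω y‖ *
        ‖iteratedFDerivWithin ℝ (k - i) (h a) Ω y‖
      < ∑ i ∈ Finset.range (k + 1), (k.choose i : ℝ) * C * (ε / (2 ^ k * C)) := by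
        refine Finset.sum_lt_sum_of_nonempty ⟨0, by simp⟩ fun i hi => ?_
        have hi' : i ≤ k := Nat.lt_succ_iff.1 (Finset.mem_range.1 hi)
        have hc : (0 : ℝ) < k.choose i := by exact_mod_cast Nat.choose_pos hi'
        have h1 : ‖iteratedFDerivWithin ℝ i g Ω y‖ ≤ C := (hM i y hy).trans (hC i hi)
        calc _ ≤ (k.choose i : ℝ) * C * ‖iteratedFDerivWithin ℝ (k - i) (h a) Ω y‖ := by gcongr
          _ < _ := mul_lt_mul_of_pos_left (ha i hi y hy) (by positivity)
    _ = ε := by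
        rw [← Finset.sum_mul, ← Finset.sum_mul, ← Nat.cast_sum, Nat.sum_range_choose]
        push_cast
        field_simp

theorem UniformlySmall.sum (hΩ : IsOpen Ω) {κ : Type*} (s : Finset κ) {h : κ → ι → E3 → ℝ}
    (hh : ∀ c, UniformlySmall 𝓁 Ω (h c)) (hs : ∀ c a, ContDiffOn ℝ ∞ (h c a) Ω) :
    UniformlySmall 𝓁 Ω fun a y => ∑ c ∈ s, h c a y := by
  classical
  induction s using Finset.induction_on with
  | empty => simpa using uniformlySmall_zero
  | insert c s hc ih =>
    simp only [Finset.sum_insert hc]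
    exact (hh c).add hΩ ih (hs c) fun a => ContDiffOn.sum fun d _ => hs d a

end UniformlySmall

/-! ### The topology on spaces of forms and continuity criteria -/

section FormTopology

variable {S : Type*} [TopologicalSpace S] [ChartedSpace E3 S] [IsManifold (𝓡 3) ∞ S]
  {V : S → Type*} [TopologicalSpace (TotalSpace F4 V)] [∀ x, AddCommGroup (V x)]
  [∀ x, Module ℝ (V x)] [∀ x, TopologicalSpace (V x)] [FiberBundle F4 V] [VectorBundle ℝ F4 V]

variable (V) in
/-- The coordinate image of the neighbourhood of `x₀` on which local representatives are defined. -/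
def chartDomain (x₀ : S) : Set E3 := chartAt E3 x₀ '' nbhd V x₀

theorem isOpen_chartDomain (x₀ : S) : IsOpen (chartDomain V x₀) :=
  (chartAt E3 x₀).isOpen_image_of_subset_source (isOpen_nbhd x₀) Set.inter_subset_left

theorem chartDomain_subset_target (x₀ : S) : chartDomain V x₀ ⊆ (chartAt E3 x₀).target := by
  rintro _ ⟨x, hx, rfl⟩
  exact (chartAt E3 x₀).map_source hx.1

theorem symm_mem_nbhd {x₀ : S} {y : E3} (hy : y ∈ chartDomain V x₀) :
    (chartAt E3 x₀).symm y ∈ nbhd V x₀ := by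
  obtain ⟨x, hx, rfl⟩ := hy
  rwa [(chartAt E3 x₀).left_inv hx.1]

theorem contDiffOn_comp_chart_symm {x₀ : S} {g : S → ℝ}
    (hg : ContMDiffOn (𝓡 3) 𝓘(ℝ) ∞ g (nbhd V x₀)) :
    ContDiffOn ℝ ∞ (g ∘ (chartAt E3 x₀).symm) (chartDomain V x₀) := by
  rw [← contMDiffOn_iff_contDiffOn]
  exact hg.comp ((contMDiffOn_chart_symm (I := 𝓡 3) (x := x₀)).mono (chartDomain_subset_target x₀))
    fun y hy => symm_mem_nbhd hy

/-- A functional of the local representative of a form, in coordinates. -/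
def localFun {i j : ℕ} (x₀ : S) (φ : Module.Dual ℝ (ModelForm i j)) (α : Form V i j) : E3 → ℝ :=
  (fun x => φ (localRep x₀ x (α.val x))) ∘ (chartAt E3 x₀).symm

theorem contDiffOn_localFun {i j : ℕ} (x₀ : S) (φ : Module.Dual ℝ (ModelForm i j))
    (α : Form V i j) : ContDiffOn ℝ ∞ (localFun x₀ φ α) (chartDomain V x₀) :=
  contDiffOn_comp_chart_symm (α.contMDiffOn_dual x₀ φ)

theorem localFun_sub {i j : ℕ} (x₀ : S) (φ : Module.Dual ℝ (ModelForm i j)) (α β : Form V i j) :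
    localFun x₀ φ (α - β) = localFun x₀ φ α - localFun x₀ φ β := by
  funext y
  have h : α.val = (α - β).val + β.val := by rw [← val_add, sub_add_cancel]
  rw [Pi.sub_apply, eq_sub_iff_add_eq]
  change _ = φ (localRep x₀ _ (α.val _))
  rw [h, Pi.add_apply, map_add, map_add]
  rfl

/-- This unfolds the infimum of induced topologies. Derivatives within the open set `chartDomain V
x₀` agree there with unrestricted ones, and are linear on the smooth components, so a distance of
derivatives becomes the norm of a derivative of the difference. -/
theorem tendsto_form_iff_evalDual {i j : ℕ} {ι : Type*} {𝓁 : Filter ι} {F : ι → Form V i j}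
    {α : Form V i j} : Filter.Tendsto F 𝓁 (𝓝 α) ↔ ∀ x₀ v l,
      UniformlySmall 𝓁 (chartDomain V x₀) fun a => localFun x₀ (evalDual v l) (F a - α) := by
  rw [show 𝓝 α = _ from nhds_iInf (a := α)]
  simp only [nhds_iInf, nhds_induced, Filter.tendsto_iInf, Filter.tendsto_comap_iff,
    UniformOnFun.tendsto_iff_tendstoUniformlyOn, Metric.tendstoUniformlyOn_iff]
  refine forall_congr' fun x₀ => forall_congr' fun v => forall_congr' fun l =>
    forall_congr' fun k => forall_congr' fun K => ⟨fun h hK hKΩ ε hε => ?_, fun h hK ε hε => ?_⟩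
  all_goals
    have hk : (k : WithTop ℕ∞) ≤ ∞ := by exact_mod_cast le_top
    have key : ∀ a, ∀ y ∈ chartDomain V x₀,
        dist (iteratedFDeriv ℝ k (component α.val x₀ v l ∘ (chartAt E3 x₀).symm) y)
          (iteratedFDeriv ℝ k (component (F a).val x₀ v l ∘ (chartAt E3 x₀).symm) y) =
        ‖iteratedFDerivWithin ℝ k (localFun x₀ (evalDual v l) (F a - α)) (chartDomain V x₀) y‖ := by
      intro a y hy
      have hu := (isOpen_chartDomain (V := V) x₀).uniqueDiffOn (𝕜 := ℝ)
      rw [localFun_sub, iteratedFDerivWithin_sub_apply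
        (((contDiffOn_localFun x₀ (evalDual v l) (F a)) y hy).of_le hk)
        (((contDiffOn_localFun x₀ (evalDual v l) α) y hy).of_le hk) hu hy,
        iteratedFDerivWithin_of_isOpen k (isOpen_chartDomain x₀) hy,
        iteratedFDerivWithin_of_isOpen k (isOpen_chartDomain x₀) hy, dist_comm, dist_eq_norm]
      rfl
  · filter_upwards [h ⟨hK, hKΩ⟩ ε hε] with a ha y hy
    rw [← key a y (hKΩ hy)]
    exact ha y hy
  · filter_upwards [h hK.1 hK.2 ε hε] with a ha y hy
    refine (key a y (hK.2 hy)).trans_lt ?_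
    exact ha y hy

theorem Filter.Tendsto.uniformlySmall_localFun {i j : ℕ} {ι : Type*} {𝓁 : Filter ι}
    {F : ι → Form V i j} {α : Form V i j} (h : Filter.Tendsto F 𝓁 (𝓝 α)) (x₀ : S)
    (φ : Module.Dual ℝ (ModelForm i j)) :
    UniformlySmall 𝓁 (chartDomain V x₀) fun a => localFun x₀ φ (F a - α) := by
  induction φ using dual_induction with
  | eval v l => exact tendsto_form_iff_evalDual.1 h x₀ v l
  | zero => exact uniformlySmall_zero
  | add φ ψ h1 h2 =>
    exact h1.add (isOpen_chartDomain x₀) h2 (fun a => contDiffOn_localFun x₀ φ _)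
      fun a => contDiffOn_localFun x₀ ψ _
  | smul c φ h =>
    exact UniformlySmall.mul (isOpen_chartDomain x₀) (contDiffOn_const (c := c)) h
      fun a => contDiffOn_localFun x₀ φ _

/-- A linear operator between spaces of forms which is given locally by a matrix of smooth functions
is continuous. -/
theorem continuous_of_local_matrix {i j i' j' : ℕ} (A : Form V i j →ₗ[ℝ] Form V i' j')
    (hA : ∀ x₀ v l, ∃ (κ : Type) (_ : Fintype κ) (g : κ → S → ℝ)
        (φ : κ → Module.Dual ℝ (ModelForm i j)),
      (∀ c, ContMDiffOn (𝓡 3) 𝓘(ℝ) ∞ (g c) (nbhd V x₀)) ∧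
      ∀ (α : Form V i j), ∀ x ∈ nbhd V x₀, component (A α).val x₀ v l x =
        ∑ c, g c x * φ c (localRep x₀ x (α.val x))) : Continuous A := by
  rw [continuous_iff_continuousAt]
  intro α
  refine tendsto_form_iff_evalDual.2 fun x₀ v l => ?_
  obtain ⟨κ, _, g, φ, hg, hc⟩ := hA x₀ v l
  have h0 : ∀ c, UniformlySmall (𝓝 α) (chartDomain V x₀) fun β y =>
      (g c ∘ (chartAt E3 x₀).symm) y * localFun x₀ (φ c) (β - α) y := fun c =>
    UniformlySmall.mul (isOpen_chartDomain x₀) (contDiffOn_comp_chart_symm (hg c))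
      (Filter.Tendsto.uniformlySmall_localFun Filter.tendsto_id x₀ (φ c))
      fun β => contDiffOn_localFun x₀ (φ c) _
  refine (UniformlySmall.sum (isOpen_chartDomain x₀) Finset.univ h0 fun c β =>
    (contDiffOn_comp_chart_symm (hg c)).mul (contDiffOn_localFun x₀ (φ c) _)).congr ?_
  intro β y hy
  rw [← map_sub]
  exact hc (β - α) _ (symm_mem_nbhd hy)

/-- Functionals of local representatives depend continuously on the form and on the point. -/
theorem continuousOn_localRep {i j : ℕ} (x₀ : S) (φ : Module.Dual ℝ (ModelForm i j)) :
    ContinuousOn (fun p : Form V i j × S => φ (localRep x₀ p.2 (p.1.val p.2)))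
      (Set.univ ×ˢ nbhd V x₀) := by
  rintro ⟨α, x⟩ ⟨-, hx⟩
  refine ContinuousAt.continuousWithinAt ?_
  have hxΩ : chartAt E3 x₀ x ∈ chartDomain V x₀ := ⟨x, hx, rfl⟩
  obtain ⟨K, hKx, hKΩ, hK⟩ := local_compact_nhds ((isOpen_chartDomain (V := V) x₀).mem_nhds hxΩ)
  -- Order zero suffices: uniform closeness to `α` on a compact neighbourhood of the point, combined
  -- with continuity of the component of `α` itself.
  have hs := Filter.Tendsto.uniformlySmall_localFun (V := V) (Filter.tendsto_id (x := 𝓝 α)) x₀ φ 0 K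
    hK hKΩ
  have hc : ContinuousAt (fun z => φ (localRep x₀ z (α.val z))) x :=
    (α.contMDiffOn_dual x₀ φ).continuousOn.continuousAt ((isOpen_nbhd x₀).mem_nhds hx)
  have hN : ∀ᶠ z in 𝓝 x, z ∈ nbhd V x₀ ∧ chartAt E3 x₀ z ∈ K :=
    ((isOpen_nbhd x₀).eventually_mem hx).and
      (((chartAt E3 x₀).continuousAt hx.1).eventually_mem hKx)
  rw [ContinuousAt, Metric.tendsto_nhds]
  intro ε hε
  rw [nhds_prod_eq]
  filter_upwards [(hs (ε / 2) (by positivity)).prod_mk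
    (hN.and (Metric.tendsto_nhds.1 hc (ε / 2) (by positivity)))] with p hp
  obtain ⟨h1, ⟨h2, h3⟩, h4⟩ := hp
  have h5 := h1 _ h3
  rw [norm_iteratedFDerivWithin_zero, id, localFun_sub, Pi.sub_apply] at h5
  change ‖(fun z => φ (localRep x₀ z (p.1.val z)) - φ (localRep x₀ z (α.val z)))
    ((chartAt E3 x₀).symm (chartAt E3 x₀ p.2))‖ < ε / 2 at h5
  rw [(chartAt E3 x₀).left_inv h2.1] at h5
  calc dist (φ (localRep x₀ p.2 (p.1.val p.2))) (φ (localRep x₀ x (α.val x)))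
      ≤ dist (φ (localRep x₀ p.2 (p.1.val p.2))) (φ (localRep x₀ p.2 (α.val p.2))) +
        dist (φ (localRep x₀ p.2 (α.val p.2))) (φ (localRep x₀ x (α.val x))) := dist_triangle _ _ _
    _ < ε / 2 + ε / 2 := add_lt_add (by rwa [dist_eq_norm]) h4
    _ = ε := by ring

end FormTopology

/-! ### Coefficients of least norm with respect to a spanning family -/

section Pseudoinverse

variable {n d : ℕ} {B : Type*} [AddCommMonoid B] [Module ℝ B]

/-- The matrix of the coordinates of a family of vectors. -/
def coordMatrix (κ : B →ₗ[ℝ] (Fin d → ℝ)) (γ : Fin n → B) : Matrix (Fin d) (Fin n) ℝ :=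
  Matrix.of fun s k => κ (γ k) s

/-- The coefficients of least norm which express a vector by a spanning family. -/
def minCoeff (κ : B →ₗ[ℝ] (Fin d → ℝ)) (γ : Fin n → B) (θ : B) : Fin n → ℝ :=
  Matrix.mulVec (coordMatrix κ γ).transpose
    (Matrix.mulVec (coordMatrix κ γ * (coordMatrix κ γ).transpose)⁻¹ (κ θ))

theorem coordMatrix_mulVec (κ : B →ₗ[ℝ] (Fin d → ℝ)) (γ : Fin n → B) (c : Fin n → ℝ) :
    Matrix.mulVec (coordMatrix κ γ) c = κ (∑ k, c k • γ k) := by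
  funext s
  simp [coordMatrix, Matrix.mulVec, dotProduct, map_sum, mul_comm]

/-- If `A Aᵀ y = 0` then `|Aᵀ y|² = 0`, so `y` is orthogonal to the coordinates of every `γ k`,
hence of every vector; as `y` is itself such a coordinate vector, it vanishes. -/
theorem det_gram_ne_zero {κ : B →ₗ[ℝ] (Fin d → ℝ)} (hκ : Function.Surjective κ) {γ : Fin n → B}
    (hγ : Submodule.span ℝ (Set.range γ) = ⊤) :
    (coordMatrix κ γ * (coordMatrix κ γ).transpose).det ≠ 0 := by
  rw [← isUnit_iff_ne_zero, ← Matrix.isUnit_iff_isUnit_det, ← Matrix.mulVec_injective_iff_isUnit]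
  rw [← Matrix.coe_mulVecLin, ← LinearMap.ker_eq_bot]
  rw [LinearMap.ker_eq_bot']
  intro y hy
  have h0 : Matrix.mulVec (coordMatrix κ γ).transpose y = 0 := by
    have h1 : dotProduct y (Matrix.mulVec (coordMatrix κ γ * (coordMatrix κ γ).transpose) y) = 0 := by
      rw [← Matrix.coe_mulVecLin, hy, dotProduct_zero]
    rw [← Matrix.mulVec_mulVec, Matrix.dotProduct_mulVec, ← Matrix.mulVec_transpose,
      dotProduct_self_eq_zero] at h1
    exact h1
  have h2 : ∀ b : B, dotProduct (κ b) y = 0 := by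
    intro b
    have hb : b ∈ Submodule.span ℝ (Set.range γ) := hγ ▸ Submodule.mem_top
    induction hb using Submodule.span_induction with
    | mem b hb =>
      obtain ⟨k, rfl⟩ := hb
      exact congrFun h0 k
    | zero => rw [map_zero, zero_dotProduct]
    | add a b _ _ ha hb => rw [map_add, add_dotProduct, ha, hb, add_zero]
    | smul c b _ hb => rw [map_smul, smul_dotProduct, hb, smul_zero]
  obtain ⟨b, rfl⟩ := hκ y
  exact dotProduct_self_eq_zero.1 (h2 b)

theorem sum_minCoeff {κ : B →ₗ[ℝ] (Fin d → ℝ)} (hκ : Function.Bijective κ) {γ : Fin n → B}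
    (hγ : Submodule.span ℝ (Set.range γ) = ⊤) (θ : B) : ∑ k, minCoeff κ γ θ k • γ k = θ := by
  apply hκ.1
  rw [← coordMatrix_mulVec, minCoeff, Matrix.mulVec_mulVec, Matrix.mulVec_mulVec,
    Matrix.mul_nonsing_inv _ (det_gram_ne_zero hκ.2 hγ).isUnit, Matrix.one_mulVec]

/-- The coefficients of least norm do not depend on the coordinates. -/
theorem minCoeff_eq {κ : B →ₗ[ℝ] (Fin d → ℝ)} (hκ : Function.Bijective κ)
    {d' : ℕ} {κ' : B →ₗ[ℝ] (Fin d' → ℝ)} (hκ' : Function.Bijective κ') {γ : Fin n → B}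
    (hγ : Submodule.span ℝ (Set.range γ) = ⊤) (θ : B) : minCoeff κ γ θ = minCoeff κ' γ θ := by
  have h1 := sum_minCoeff hκ hγ θ
  have h2 := sum_minCoeff hκ' hγ θ
  -- Both coefficient vectors express the same `θ`, so their difference is a relation among the `γ
  -- k` and is orthogonal to the row space of every coordinate matrix. Each of the two vectors lies
  -- in such a row space, so the difference is orthogonal to itself.
  have orth : ∀ {m : ℕ} (κ'' : B →ₗ[ℝ] (Fin m → ℝ)) (y : Fin m → ℝ),
      dotProduct (minCoeff κ γ θ - minCoeff κ' γ θ)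
        (Matrix.mulVec (coordMatrix κ'' γ).transpose y) = 0 := by
    intro m κ'' y
    rw [Matrix.dotProduct_mulVec, Matrix.vecMul_transpose, Matrix.mulVec_sub, coordMatrix_mulVec,
      coordMatrix_mulVec, h1, h2, sub_self, zero_dotProduct]
  rw [← sub_eq_zero, ← dotProduct_self_eq_zero]
  have o1 : dotProduct (minCoeff κ γ θ - minCoeff κ' γ θ) (minCoeff κ γ θ) = 0 := orth κ _
  have o2 : dotProduct (minCoeff κ γ θ - minCoeff κ' γ θ) (minCoeff κ' γ θ) = 0 := orth κ' _
  conv_lhs => rw [dotProduct_sub]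
  rw [o1, o2, sub_zero]

theorem minCoeff_apply (κ : B →ₗ[ℝ] (Fin d → ℝ)) (γ : Fin n → B) (θ : B) (k : Fin n) :
    minCoeff κ γ θ k = ∑ t, (∑ s, κ (γ k) s *
      (coordMatrix κ γ * (coordMatrix κ γ).transpose)⁻¹ s t) * κ θ t := by
  rw [minCoeff]
  simp only [Matrix.mulVec, dotProduct, Matrix.transpose_apply, Finset.mul_sum, Finset.sum_mul]
  rw [Finset.sum_comm]
  refine Finset.sum_congr rfl fun t _ => Finset.sum_congr rfl fun s _ => ?_
  rw [mul_assoc]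
  rfl

end Pseudoinverse

/-! ### Smoothness of determinants and inverse matrices -/

section MatrixSmooth

variable {S : Type*} [TopologicalSpace S] [ChartedSpace E3 S] {d : ℕ} {U : Set S}

theorem contMDiffOn_det {A : S → Matrix (Fin d) (Fin d) ℝ}
    (hA : ∀ s t, ContMDiffOn (𝓡 3) 𝓘(ℝ) ∞ (fun x => A x s t) U) :
    ContMDiffOn (𝓡 3) 𝓘(ℝ) ∞ (fun x => (A x).det) U := by
  simp only [Matrix.det_apply']
  exact contMDiffOn_finsetSum fun σ _ => contMDiffOn_const.mul
    (contMDiffOn_finsetProd fun s _ => hA _ _)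

theorem contMDiffOn_inv {A : S → Matrix (Fin d) (Fin d) ℝ}
    (hA : ∀ s t, ContMDiffOn (𝓡 3) 𝓘(ℝ) ∞ (fun x => A x s t) U) (h0 : ∀ x ∈ U, (A x).det ≠ 0)
    (s t : Fin d) : ContMDiffOn (𝓡 3) 𝓘(ℝ) ∞ (fun x => (A x)⁻¹ s t) U := by
  simp only [Matrix.inv_def, Ring.inverse_eq_inv', Matrix.smul_apply, smul_eq_mul,
    Matrix.adjugate_apply]
  -- Cramer's rule: an entry of the adjugate is the determinant of `A` with row `t` replaced by a
  -- constant one.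
  refine ((contMDiffOn_det hA).inv₀ h0).mul (contMDiffOn_det fun p q => ?_)
  by_cases hp : p = t
  · subst hp
    simpa using contMDiffOn_const
  · simpa [Matrix.updateRow_ne hp] using hA p q

end MatrixSmooth

/-! ### A continuous right inverse for fibrewise surjective operators -/

section RightInverse

variable {S : Type*} [TopologicalSpace S] [ChartedSpace E3 S] [IsManifold (𝓡 3) ∞ S]
  [T2Space S] [CompactSpace S]
  {V : S → Type*} [TopologicalSpace (TotalSpace F4 V)] [∀ x, AddCommGroup (V x)]
  [∀ x, Module ℝ (V x)] [∀ x, TopologicalSpace (V x)] [FiberBundle F4 V] [VectorBundle ℝ F4 V]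
  [ContMDiffVectorBundle ∞ F4 V (𝓡 3)]

/-- Finitely many forms span all fibres. -/
theorem exists_spanning_forms (i j : ℕ) : ∃ (n : ℕ) (β : Fin n → Form V i j),
    ∀ x, Submodule.span ℝ (Set.range fun k => (β k).val x) = ⊤ := by
  have h1 : ∀ x₀ : S, ∃ f : S → ℝ, ContMDiff (𝓡 3) 𝓘(ℝ) ∞ f ∧ tsupport f ⊆ nbhd V x₀ ∧
      f x₀ = 1 := fun x₀ => by
    obtain ⟨f, -, hf⟩ := (SmoothBumpFunction.nhds_basis_tsupport (I := 𝓡 3) x₀).mem_iff.1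
      ((isOpen_nbhd (V := V) x₀).mem_nhds (mem_nbhd_self x₀))
    exact ⟨f, f.contMDiff, hf, f.eq_one⟩
  choose f hf hs h1 using h1
  -- At each point one of finitely many cut-off functions is non-zero, and its multiples of the
  -- lifted model basis span the fibre there.
  obtain ⟨t, ht⟩ := isCompact_univ.elim_finite_subcover (fun x₀ => {x | f x₀ x ≠ 0})
    (fun x₀ => isOpen_ne_fun (hf x₀).continuous continuous_const) fun x _ =>
      Set.mem_iUnion.2 ⟨x, by simp [h1 x]⟩
  let b := Module.finBasis ℝ (ModelForm i j)
  let β : t × Fin (Module.finrank ℝ (ModelForm i j)) → Form V i j :=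
    fun p => cutoffForm p.1.1 (f p.1.1) (hf _) (hs _) (b p.2)
  let e := Fintype.equivFin (t × Fin (Module.finrank ℝ (ModelForm i j)))
  refine ⟨_, fun k => β (e.symm k), fun x => ?_⟩
  rw [Submodule.eq_top_iff']
  intro α
  obtain ⟨x₀, hx₀, hx⟩ : ∃ x₀ ∈ t, f x₀ x ≠ 0 := by simpa using ht (Set.mem_univ x)
  have hxn : x ∈ nbhd V x₀ := hs x₀ (subset_tsupport _ hx)
  rw [← localLift_localRep hxn α, ← b.sum_repr (localRep x₀ x α), map_sum]
  refine Submodule.sum_mem _ fun s _ => ?_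
  rw [map_smul]
  refine Submodule.smul_mem _ _ ?_
  have h2 : (localLift x₀ x (b s) : (TangentSpace (𝓡 3) x) [⋀^Fin i]→ₗ[ℝ] ⋀[ℝ]^j (V x)) =
      (f x₀ x)⁻¹ • (β (⟨x₀, hx₀⟩, s)).val x := by
    change _ = (f x₀ x)⁻¹ • f x₀ x • localLift x₀ x (b s)
    rw [inv_smul_smul₀ hx]
  rw [h2]
  exact Submodule.smul_mem _ _ (Submodule.subset_span ⟨e (⟨x₀, hx₀⟩, s), by simp⟩)

/-- The coordinates of the fibre at `x` defined by the chart and trivialization at `x₀`. -/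
def fibreCoord {i j : ℕ} (x₀ x : S) :
    ((TangentSpace (𝓡 3) x) [⋀^Fin i]→ₗ[ℝ] ⋀[ℝ]^j (V x)) →ₗ[ℝ]
      (Fin (Module.finrank ℝ (ModelForm i j)) → ℝ) :=
  (Module.finBasis ℝ (ModelForm i j)).equivFun.toLinearMap ∘ₗ localRep x₀ x

theorem fibreCoord_apply {i j : ℕ} (x₀ x : S)
    (α : (TangentSpace (𝓡 3) x) [⋀^Fin i]→ₗ[ℝ] ⋀[ℝ]^j (V x)) (s) :
    fibreCoord x₀ x α s = (Module.finBasis ℝ (ModelForm i j)).coord s (localRep x₀ x α) := rfl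

theorem fibreCoord_bijective {i j : ℕ} {x₀ x : S} (hx : x ∈ nbhd V x₀) :
    Function.Bijective (fibreCoord x₀ x :
      ((TangentSpace (𝓡 3) x) [⋀^Fin i]→ₗ[ℝ] ⋀[ℝ]^j (V x)) →ₗ[ℝ] _) :=
  (Module.finBasis ℝ (ModelForm i j)).equivFun.bijective.comp
    ⟨localRep_injective hx, fun a => ⟨_, localRep_localLift hx a⟩⟩

/-- The coefficient functions in local coordinates. -/
theorem contMDiffOn_minCoeff_matrix {i j n : ℕ} (γ : Fin n → Form V i j)
    (hγ : ∀ x, Submodule.span ℝ (Set.range fun k => (γ k).val x) = ⊤) (x₀ : S) (k : Fin n) (t) :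
    ContMDiffOn (𝓡 3) 𝓘(ℝ) ∞ (fun x => ∑ s, fibreCoord x₀ x ((γ k).val x) s *
      (coordMatrix (fibreCoord x₀ x) (fun k => (γ k).val x) *
        (coordMatrix (fibreCoord x₀ x) (fun k => (γ k).val x)).transpose)⁻¹ s t) (nbhd V x₀) := by
  have h : ∀ k s, ContMDiffOn (𝓡 3) 𝓘(ℝ) ∞ (fun x => fibreCoord x₀ x ((γ k).val x) s)
    (nbhd V x₀) := fun k s =>
    (γ k).contMDiffOn_dual x₀ ((Module.finBasis ℝ (ModelForm i j)).coord s)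
  refine contMDiffOn_finsetSum fun s _ => (h k s).mul (contMDiffOn_inv (fun p q => ?_) ?_ s t)
  · simp only [Matrix.mul_apply, Matrix.transpose_apply, coordMatrix, Matrix.of_apply]
    exact contMDiffOn_finsetSum fun k _ => (h k p).mul (h k q)
  · exact fun x hx => det_gram_ne_zero (fibreCoord_bijective hx).2 (hγ x)

/-- A fibrewise surjective operator between spaces of forms has a continuous right inverse. -/
theorem exists_continuous_rightInverse {i j i' j' : ℕ}
    (W : ∀ x : S, ((TangentSpace (𝓡 3) x) [⋀^Fin i]→ₗ[ℝ] ⋀[ℝ]^j (V x)) →ₗ[ℝ]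
      ((TangentSpace (𝓡 3) x) [⋀^Fin i']→ₗ[ℝ] ⋀[ℝ]^j' (V x)))
    (hW : ∀ x, Function.Surjective (W x)) (A : Form V i j →ₗ[ℝ] Form V i' j')
    (hA : ∀ α x, (A α).val x = W x (α.val x)) :
    ∃ R : Form V i' j' →ₗ[ℝ] Form V i j, Continuous R ∧ ∀ Θ, A (R Θ) = Θ := by
  obtain ⟨n, β, hβ⟩ := exists_spanning_forms (V := V) i j
  let γ : Fin n → Form V i' j' := fun k => A (β k)
  have hγ : ∀ x, Submodule.span ℝ (Set.range fun k => (γ k).val x) = ⊤ := by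
    intro x
    have h1 : (fun k => (γ k).val x) = W x ∘ fun k => (β k).val x := funext fun k => hA _ _
    rw [h1, Set.range_comp, ← Submodule.map_span, hβ x, Submodule.map_top,
      LinearMap.range_eq_top.2 (hW x)]
  let m := fun x₀ x : S => fun (k : Fin n) (t : Fin (Module.finrank ℝ (ModelForm i' j'))) =>
    ∑ s, fibreCoord x₀ x ((γ k).val x) s *
      (coordMatrix (fibreCoord x₀ x) (fun k => (γ k).val x) *
        (coordMatrix (fibreCoord x₀ x) (fun k => (γ k).val x)).transpose)⁻¹ s t
  -- At each `x` the coordinates are those of its own chart, which need not vary continuously with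
  -- `x`. The independence `minCoeff_eq` allows any fixed chart `x₀` near `x` to be used instead;
  -- `hcomp` records the resulting smooth matrix, which gives both smoothness of the values and
  -- continuity of `R`.
  let val := fun (Θ : RoughForm V i' j') (x : S) =>
    ∑ k, minCoeff (fibreCoord x x) (fun k => (γ k).val x) (Θ x) k • (β k).val x
  have hcomp : ∀ (Θ : RoughForm V i' j') x₀ v l, ∀ x ∈ nbhd V x₀, component (val Θ) x₀ v l x =
      ∑ t, (∑ k, m x₀ x k t * component (β k).val x₀ v l x) *
        (Module.finBasis ℝ (ModelForm i' j')).coord t (localRep x₀ x (Θ x)) := by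
    intro Θ x₀ v l x hx
    have e := minCoeff_eq (fibreCoord_bijective (mem_nbhd_self x))
      (fibreCoord_bijective hx) (hγ x) (Θ x)
    rw [component_eq]
    simp only [val]
    rw [e, map_sum, map_sum]
    simp only [m, map_smul, minCoeff_apply, smul_eq_mul, Finset.sum_mul, ← component_eq,
      ← fibreCoord_apply]
    rw [Finset.sum_comm]
    refine Finset.sum_congr rfl fun t _ => Finset.sum_congr rfl fun k _ =>
      Finset.sum_congr rfl fun s _ => ?_
    ring
  have hsm : ∀ x₀ v l t, ContMDiffOn (𝓡 3) 𝓘(ℝ) ∞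
      (fun x => ∑ k, m x₀ x k t * component (β k).val x₀ v l x) (nbhd V x₀) := fun x₀ v l t =>
    contMDiffOn_finsetSum fun k _ => (contMDiffOn_minCoeff_matrix γ hγ x₀ k t).mul
      ((β k).smooth x₀ v l)
  let R : Form V i' j' →ₗ[ℝ] Form V i j :=
    { toFun := fun Θ => ⟨val Θ.val, fun x₀ v l =>
        (contMDiffOn_finsetSum fun t _ => (hsm x₀ v l t).mul (Θ.contMDiffOn_dual x₀ _)).congr
          fun x hx => hcomp Θ.val x₀ v l x hx⟩
      map_add' := fun Θ Θ' => Form.ext (funext fun x => by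
        simp [val, val_add, minCoeff, Matrix.mulVec_add, add_smul, Finset.sum_add_distrib])
      map_smul' := fun c Θ => Form.ext (funext fun x => by
        simp [val, val_smul, minCoeff, Matrix.mulVec_smul, mul_smul, Finset.smul_sum]) }
  refine ⟨R, continuous_of_local_matrix R fun x₀ v l => ⟨_, _, _, _, hsm x₀ v l, fun Θ x hx =>
    hcomp Θ.val x₀ v l x hx⟩, fun Θ => Form.ext (funext fun x => ?_)⟩
  rw [hA]
  change W x (∑ k, minCoeff (fibreCoord x x) (fun k => (γ k).val x) (Θ.val x) k • (β k).val x) = _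
  rw [map_sum]
  simp only [map_smul, ← hA]
  exact sum_minCoeff (fibreCoord_bijective (mem_nbhd_self x)) (hγ x) (Θ.val x)

end RightInverse

/-! ### Linearity of the wedge product in its first factor -/

section FibreLinearity

variable {T W : Type*} [AddCommGroup T] [Module ℝ T] [AddCommGroup W] [Module ℝ W]

theorem add_fibreWedge {i j k l : ℕ} (α γ : T [⋀^Fin i]→ₗ[ℝ] ⋀[ℝ]^j W)
    (β : T [⋀^Fin k]→ₗ[ℝ] ⋀[ℝ]^l W) :
    fibreWedge (α + γ) β = fibreWedge α β + fibreWedge γ β := by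
  ext1 v
  rw [AlternatingMap.add_apply]
  simp only [fibreWedge_apply, AlternatingMap.add_apply, map_add, LinearMap.add_apply, smul_add,
    Finset.sum_add_distrib]

theorem smul_fibreWedge {i j k l : ℕ} (c : ℝ) (α : T [⋀^Fin i]→ₗ[ℝ] ⋀[ℝ]^j W)
    (β : T [⋀^Fin k]→ₗ[ℝ] ⋀[ℝ]^l W) :
    fibreWedge (c • α) β = c • fibreWedge α β := by
  ext1 v
  rw [AlternatingMap.smul_apply]
  simp only [fibreWedge_apply, AlternatingMap.smul_apply, map_smul, LinearMap.smul_apply,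
    Finset.smul_sum]
  refine Finset.sum_congr rfl fun q _ => ?_
  rw [smul_comm _ c, smul_comm _ c]

end FibreLinearity

/-! ### Densities of top forms: continuity and sign -/

section Density

variable {S : Type*} [TopologicalSpace S] [ChartedSpace E3 S] [IsManifold (𝓡 3) ∞ S]
  {V : S → Type*} [TopologicalSpace (TotalSpace F4 V)] [∀ x, AddCommGroup (V x)]
  [∀ x, Module ℝ (V x)] [∀ x, TopologicalSpace (V x)] [FiberBundle F4 V] [VectorBundle ℝ F4 V]

/-- The coordinate frame as a basis of the tangent space. -/
def coordBasis {x₀ x : S} (hx : x ∈ (chartAt E3 x₀).source) :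
    Module.Basis (Fin 3) ℝ (TangentSpace (𝓡 3) x) :=
  (EuclideanSpace.basisFun (Fin 3) ℝ).toBasis.map
    ((trivializationAt E3 (TangentSpace (𝓡 3) : S → Type _) x₀).linearEquivAt ℝ x
      (mem_tangent_baseSet hx)).symm

theorem coordBasis_apply {x₀ x : S} (hx : x ∈ (chartAt E3 x₀).source) (n : Fin 3) :
    coordBasis hx n = coordFrame x₀ x n := by
  rw [coordBasis, Module.Basis.map_apply, coordFrame, coordVec,
    Trivialization.symmₗ_apply _ (mem_tangent_baseSet hx)]
  simp

theorem coe_coordBasis {x₀ x : S} (hx : x ∈ (chartAt E3 x₀).source) :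
    ⇑(coordBasis hx) = coordFrame x₀ x := funext (coordBasis_apply hx)

/-- The coefficient of a top form at a point with respect to a triple of tangent vectors. -/
def volumeCoeff (L : LorentzStructure V) (x : S) (t : Fin 3 → TangentSpace (𝓡 3) x) :
    ((TangentSpace (𝓡 3) x) [⋀^Fin 3]→ₗ[ℝ] ⋀[ℝ]^4 (V x)) →ₗ[ℝ] ℝ where
  toFun ξ := exteriorPower.alternatingMapLinearEquiv (L.vol x) (ξ t)
  map_add' ξ ξ' := by rw [AlternatingMap.add_apply, map_add]
  map_smul' c ξ := by rw [AlternatingMap.smul_apply, map_smul]; rfl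

theorem density_eq (o : ManifoldOrientation S) (L : LorentzStructure V) (η : Form V 3 4) (x₀ x : S) :
    density o L η x₀ x =
      coordSign o.orient x₀ x * volumeCoeff L x (coordFrame x₀ x) (η.val x) := rfl

theorem contMDiffOn_volume_map (L : LorentzStructure V) (x₀ : S) (u : ⋀[ℝ]^4 F4) :
    ContMDiffOn (𝓡 3) 𝓘(ℝ) ∞ (fun x => exteriorPower.alternatingMapLinearEquiv (L.vol x)
      (exteriorPower.map 4 ((trivializationAt F4 V x₀).symmₗ ℝ x) u))
      (trivializationAt F4 V x₀).baseSet := by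
  have hu : u ∈ Submodule.span ℝ (Set.range (exteriorPower.ιMulti ℝ 4 (M := F4))) := by
    rw [exteriorPower.ιMulti_span]; trivial
  induction hu using Submodule.span_induction with
  | mem x hx =>
    obtain ⟨w, rfl⟩ := hx
    simp only [exteriorPower.map_apply_ιMulti,
      exteriorPower.alternatingMapLinearEquiv_apply_ιMulti]
    exact L.vol_smooth x₀ w
  | zero => simpa using contMDiffOn_const
  | add x y _ _ hx hy =>
    simp only [map_add]
    exact hx.add hy
  | smul c x _ hx =>
    simp only [map_smul, smul_eq_mul]
    exact contMDiffOn_const.mul hx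

theorem contMDiffOn_volumeCoeff_localLift (L : LorentzStructure V) (x₀ y : S) (a : ModelForm 3 4) :
    ContMDiffOn (𝓡 3) 𝓘(ℝ) ∞
      (fun x => volumeCoeff L x (coordFrame x₀ x) (localLift y x a))
      ((chartAt E3 x₀).source ∩ nbhd V y) := by
  refine ContMDiffOn.congr (f := fun x => ∑ r : Fin 3 → Fin (Module.finrank ℝ E3),
    (∏ k, (Module.finBasis ℝ E3).repr
      ((trivializationAt E3 (TangentSpace (𝓡 3) : S → Type _) y).linearMapAt ℝ x
        ((trivializationAt E3 (TangentSpace (𝓡 3) : S → Type _) x₀).symmₗ ℝ x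
          (EuclideanSpace.basisFun (Fin 3) ℝ k))) (r k)) *
    exteriorPower.alternatingMapLinearEquiv (L.vol x)
      (exteriorPower.map 4 ((trivializationAt F4 V y).symmₗ ℝ x)
        (a fun k => Module.finBasis ℝ E3 (r k)))) ?_ fun x _ => ?_
  · refine contMDiffOn_finsetSum fun r _ => ContMDiffOn.mul ?_ ?_
    · refine contMDiffOn_finsetProd fun k _ =>
        contMDiffOn_linear_comp ((Module.finBasis ℝ E3).coord (r k))
          ((contMDiffOn_transition (TangentSpace (𝓡 3) : S → Type _) x₀ y _).mono ?_)
      exact fun x hx => ⟨mem_tangent_baseSet hx.1, mem_tangent_baseSet hx.2.1⟩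
    · exact (contMDiffOn_volume_map L y _).mono fun x hx => hx.2.2
  · change exteriorPower.alternatingMapLinearEquiv (L.vol x)
      (exteriorPower.map 4 ((trivializationAt F4 V y).symmₗ ℝ x) (a.toMultilinearMap fun n =>
        (trivializationAt E3 (TangentSpace (𝓡 3) : S → Type _) y).linearMapAt ℝ x
        ((trivializationAt E3 (TangentSpace (𝓡 3) : S → Type _) x₀).symmₗ ℝ x
          (EuclideanSpace.basisFun (Fin 3) ℝ n)))) = _
    rw [multilinear_expand]
    simp only [map_sum, map_smul, smul_eq_mul]
    rfl

/-- A family of forms whose local representatives depend jointly continuously on the parameter and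
the point. -/
def JointlyContinuous {X : Type*} [TopologicalSpace X] {i j : ℕ} (H : X → Form V i j) : Prop :=
  ∀ (y : S) (φ : Module.Dual ℝ (ModelForm i j)),
    ContinuousOn (fun p : X × S => φ (localRep y p.2 ((H p.1).val p.2))) (Set.univ ×ˢ nbhd V y)

theorem jointlyContinuous_id {i j : ℕ} : JointlyContinuous (id : Form V i j → Form V i j) :=
  fun y φ => continuousOn_localRep y φ

theorem JointlyContinuous.comp {X Y : Type*} [TopologicalSpace X] [TopologicalSpace Y] {i j : ℕ}
    {H : X → Form V i j} (hH : JointlyContinuous H) {g : Y → X} (hg : Continuous g) :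
    JointlyContinuous (H ∘ g) := fun y φ =>
  (hH y φ).comp (f := fun p : Y × S => (g p.1, p.2)) (by fun_prop) fun p hp => ⟨trivial, hp.2⟩

/-- Components of a wedge are finite sums of products of components. This is all that continuity of
the integrals requires; continuity of the wedge in both factors for the `C^∞` topology is not used.
-/
theorem JointlyContinuous.wedge {X : Type*} [TopologicalSpace X] {i j k l : ℕ}
    {H : X → Form V i j} {G : X → Form V k l} (hH : JointlyContinuous H)
    (hG : JointlyContinuous G) : JointlyContinuous fun p => wedge (H p) (G p) := by
  intro y φ
  induction φ using dual_induction with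
  | eval v m =>
    have e : ∀ p : X × S, evalDual v m (localRep y p.2 ((LPC.wedge (H p.1) (G p.1)).val p.2)) = _ :=
      fun p => congrFun (component_wedge (H p.1).val (G p.1).val y v m) p.2
    simp only [e, component_eq]
    refine continuousOn_const.mul (continuousOn_finsetSum _ fun q _ => continuousOn_const.mul
      (continuousOn_finsetSum _ fun a _ => continuousOn_finsetSum _ fun b _ => ?_))
    exact ((hH y _).mul (hG y _)).mul continuousOn_const
  | zero => exact continuousOn_const
  | add φ ψ h1 h2 => exact h1.add h2
  | smul c φ h => exact continuousOn_const.mul h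

theorem JointlyContinuous.continuousOn_density {X : Type*} [TopologicalSpace X]
    {H : X → Form V 3 4} (hH : JointlyContinuous H) (o : ManifoldOrientation S)
    (L : LorentzStructure V) (x₀ : S) :
    ContinuousOn (fun p : X × S => density o L (H p.1) x₀ p.2)
      (Set.univ ×ˢ (chartAt E3 x₀).source) := by
  simp only [density_eq]
  refine ContinuousOn.mul ((o.locallyConstant x₀).comp continuousOn_snd fun p hp => hp.2) ?_
  rintro ⟨a, y⟩ ⟨-, hy⟩
  have hU : IsOpen (Set.univ ×ˢ ((chartAt E3 x₀).source ∩ nbhd V y) : Set (X × S)) :=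
    isOpen_univ.prod ((chartAt E3 x₀).open_source.inter (isOpen_nbhd y))
  have hmem : (a, y) ∈ (Set.univ ×ˢ ((chartAt E3 x₀).source ∩ nbhd V y) : Set (X × S)) :=
    ⟨trivial, hy, mem_nbhd_self y⟩
  refine ContinuousAt.continuousWithinAt (ContinuousOn.continuousAt ?_ (hU.mem_nhds hmem))
  -- Near the point the density is a sum of jointly continuous coordinates of the form times the
  -- coefficients of the lifted basis forms, which depend on the point only.
  let b := Module.finBasis ℝ (ModelForm 3 4)
  refine ContinuousOn.congr (f := fun p : X × S =>
    ∑ s, b.coord s (localRep y p.2 ((H p.1).val p.2)) *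
      volumeCoeff L p.2 (coordFrame x₀ p.2) (localLift y p.2 (b s))) ?_ ?_
  · refine continuousOn_finsetSum _ fun s _ => ContinuousOn.mul ?_ ?_
    · exact (hH y _).mono (Set.prod_mono le_rfl Set.inter_subset_right)
    · exact (contMDiffOn_volumeCoeff_localLift L x₀ y (b s)).continuousOn.comp continuousOn_snd
        fun p hp => hp.2
  · rintro ⟨c, x⟩ ⟨-, -, hx⟩
    simp only
    conv_lhs => rw [← localLift_localRep hx ((H c).val x), ← b.sum_repr (localRep y x ((H c).val x))]
    rw [map_sum, map_sum]
    simp only [map_smul, smul_eq_mul]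
    rfl

/-- The density in any chart, in terms of a positively oriented basis. -/
theorem density_eq_abs_det (o : ManifoldOrientation S) (L : LorentzStructure V) (η : Form V 3 4)
    {x₀ x : S} (hx : x ∈ (chartAt E3 x₀).source)
    (g : Module.Basis (Fin 3) ℝ (TangentSpace (𝓡 3) x)) (hg : g.orientation = o.orient x) :
    density o L η x₀ x = |g.det (coordBasis hx)| * volumeCoeff L x g (η.val x) := by
  have h1 : volumeCoeff L x (coordFrame x₀ x) (η.val x) =
      volumeCoeff L x g (η.val x) * g.det (coordBasis hx) := by
    have h := AlternatingMap.eq_smul_basis_det g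
      ((exteriorPower.alternatingMapLinearEquiv (L.vol x)).compAlternatingMap (η.val x))
    have h2 := congrArg (fun f => f (coordBasis hx)) h
    rw [coe_coordBasis] at h2 ⊢
    exact h2
  -- Since `g` is positively oriented, the sign of the chart is the sign of this determinant.
  have h2 : coordSign o.orient x₀ x * g.det (coordBasis hx) = |g.det (coordBasis hx)| := by
    rw [coordSign]
    split_ifs with h
    · obtain ⟨f, hf, hfo⟩ := h
      have hfc : f = coordBasis hx :=
        Module.Basis.eq_of_apply_eq fun n => by rw [hf, coordBasis_apply]
      rw [hfc, ← hg] at hfo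
      rw [one_mul, abs_of_pos ((g.orientation_eq_iff_det_pos _).1 hfo.symm)]
    · have hn : ¬ 0 < g.det (coordBasis hx) := fun hp =>
        h ⟨coordBasis hx, coordBasis_apply hx,
          ((g.orientation_eq_iff_det_pos _).2 hp).symm.trans hg⟩
      rw [abs_of_nonpos (not_lt.1 hn)]
      ring
  rw [density_eq, h1, ← h2]
  ring

/-- In every chart the density is a positive multiple of one and the same number, the coefficient in
a positively oriented basis. Only this sign comparison is needed, not the change of variables
formula. -/
theorem density_pos_iff (o : ManifoldOrientation S) (L : LorentzStructure V) (η : Form V 3 4)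
    {x₀ x₁ x : S} (h₀ : x ∈ (chartAt E3 x₀).source) (h₁ : x ∈ (chartAt E3 x₁).source) :
    0 < density o L η x₀ x ↔ 0 < density o L η x₁ x := by
  have hd : Fintype.card (Fin 3) = Module.finrank ℝ (TangentSpace (𝓡 3) x) := by
    change _ = Module.finrank ℝ E3
    simp
  have := Module.finite_of_finrank_pos (R := ℝ) (M := TangentSpace (𝓡 3) x) (by rw [← hd]; simp)
  let g := (o.orient x).someBasis hd
  have hg : g.orientation = o.orient x := (o.orient x).someBasis_orientation hd
  have hne : ∀ {z : S} (hz : x ∈ (chartAt E3 z).source), 0 < |g.det (coordBasis hz)| := fun hz =>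
    abs_pos.2 (g.isUnit_det (coordBasis hz)).ne_zero
  rw [density_eq_abs_det o L η h₀ g hg, density_eq_abs_det o L η h₁ g hg, mul_pos_iff_of_pos_left
    (hne h₀), mul_pos_iff_of_pos_left (hne h₁)]

theorem density_add (o : ManifoldOrientation S) (L : LorentzStructure V) (η η' : Form V 3 4)
    (x₀ x : S) : density o L (η + η') x₀ x = density o L η x₀ x + density o L η' x₀ x := by
  rw [density_eq, val_add, Pi.add_apply, map_add, mul_add]
  rfl

theorem density_of_smul (o : ManifoldOrientation S) (L : LorentzStructure V) {η η' : Form V 3 4}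
    {x : S} {c : ℝ} (h : η'.val x = c • η.val x) (x₀ : S) :
    density o L η' x₀ x = c * density o L η x₀ x := by
  rw [density_eq, h, map_smul, smul_eq_mul, density_eq]
  ring

end Density

/-! ### Integration: linearity, continuity and positivity -/

section Integral

variable {S : Type*} [TopologicalSpace S] [ChartedSpace E3 S] [IsManifold (𝓡 3) ∞ S]
  [T2Space S] [CompactSpace S]
  {V : S → Type*} [TopologicalSpace (TotalSpace F4 V)] [∀ x, AddCommGroup (V x)]
  [∀ x, Module ℝ (V x)] [∀ x, TopologicalSpace (V x)] [FiberBundle F4 V] [VectorBundle ℝ F4 V]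

variable (S) in
/-- The coordinate image of the support of a function of the partition of unity. -/
def chartSupport (x₀ : S) : Set E3 := chartAt E3 x₀ '' tsupport (chartPartition S x₀)

theorem isCompact_chartSupport (x₀ : S) : IsCompact (chartSupport S x₀) :=
  (isClosed_tsupport _).isCompact.image_of_continuousOn
    ((chartAt E3 x₀).continuousOn.mono (chartPartition_isSubordinate x₀))

theorem chartSupport_subset (x₀ : S) : chartSupport S x₀ ⊆ (chartAt E3 x₀).target := by
  rintro _ ⟨x, hx, rfl⟩
  exact (chartAt E3 x₀).map_source (chartPartition_isSubordinate x₀ hx)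

theorem integrableOn_chartSupport (x₀ : S) (g : C(S, ℝ)) :
    IntegrableOn (fun y => g ((chartAt E3 x₀).symm y)) (chartSupport S x₀) :=
  ContinuousOn.integrableOn_compact (isCompact_chartSupport x₀)
    (g.continuous.comp_continuousOn ((chartAt E3 x₀).continuousOn_symm.mono (chartSupport_subset x₀)))

/-- Integration in the chart at `x₀`, as a continuous functional. -/
def chartIntegral (x₀ : S) : C(S, ℝ) →L[ℝ] ℝ :=
  LinearMap.mkContinuous
    { toFun := fun g => ∫ y in chartSupport S x₀, g ((chartAt E3 x₀).symm y)
      map_add' := fun g h => integral_add (integrableOn_chartSupport x₀ g)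
        (integrableOn_chartSupport x₀ h)
      map_smul' := fun c g => integral_const_mul c _ }
    (volume.real (chartSupport S x₀)) fun g => by
      rw [mul_comm]
      exact norm_setIntegral_le_of_norm_le_const (isCompact_chartSupport x₀).measure_lt_top
        fun y _ => g.norm_coe_le_norm _

/-- The density is controlled only on the chart domain, but the partition function has its closed
support there and vanishes near every other point. -/
theorem continuous_weightedDensity {X : Type*} [TopologicalSpace X] {H : X → Form V 3 4}
    (hH : JointlyContinuous H) (o : ManifoldOrientation S) (L : LorentzStructure V) (x₀ : S) :
    Continuous fun p : X × S => chartPartition S x₀ p.2 * density o L (H p.1) x₀ p.2 := by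
  rw [continuous_iff_continuousAt]
  rintro ⟨a, x⟩
  by_cases hx : x ∈ tsupport (chartPartition S x₀)
  · have h1 : ContinuousAt (fun p : X × S => density o L (H p.1) x₀ p.2) (a, x) :=
      (hH.continuousOn_density o L x₀).continuousAt
        ((isOpen_univ.prod (chartAt E3 x₀).open_source).mem_nhds
          ⟨trivial, chartPartition_isSubordinate x₀ hx⟩)
    exact ((chartPartition S x₀).contMDiff.continuous.comp continuous_snd).continuousAt.mul h1
  · have h1 : ∀ᶠ p : X × S in 𝓝 (a, x), chartPartition S x₀ p.2 = 0 :=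
      continuousAt_snd.eventually (notMem_tsupport_iff_eventuallyEq.1 hx)
    refine (continuousAt_const (y := (0 : ℝ))).congr ?_
    filter_upwards [h1] with p hp
    rw [hp, zero_mul]

/-- The density of a form in the chart at `x₀`, multiplied by the partition of unity. -/
def weightedDensity (o : ManifoldOrientation S) (L : LorentzStructure V) (x₀ : S)
    (η : Form V 3 4) : C(S, ℝ) where
  toFun x := chartPartition S x₀ x * density o L η x₀ x
  continuous_toFun := (continuous_weightedDensity jointlyContinuous_id o L x₀).comp
    (Continuous.prodMk_right η)

theorem finite_chartPartition : {x₀ : S | (chartPartition S x₀ : S → ℝ) ≠ 0}.Finite := by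
  have h := (chartPartition S).locallyFinite.finite_nonempty_of_compact
  refine h.subset fun x₀ hx₀ => ?_
  exact Function.support_nonempty_iff.2 hx₀

variable (S) in
/-- The finitely many charts which contribute to the integral. -/
def activeCharts : Finset S := (finite_chartPartition (S := S)).toFinset

theorem chartIntegral_weightedDensity (o : ManifoldOrientation S) (L : LorentzStructure V) (x₀ : S)
    (η : Form V 3 4) : chartIntegral x₀ (weightedDensity o L x₀ η) =
      ∫ y in (chartAt E3 x₀).target, chartPartition S x₀ ((chartAt E3 x₀).symm y) *
        density o L η x₀ ((chartAt E3 x₀).symm y) := by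
  change ∫ y in chartSupport S x₀, _ = _
  refine (setIntegral_eq_of_subset_of_forall_sdiff_eq_zero
    (chartAt E3 x₀).open_target.measurableSet (chartSupport_subset x₀) fun y hy => ?_).symm
  have h : (chartAt E3 x₀).symm y ∉ tsupport (chartPartition S x₀) := fun hs =>
    hy.2 ⟨_, hs, (chartAt E3 x₀).right_inv hy.1⟩
  change chartPartition S x₀ ((chartAt E3 x₀).symm y) * _ = 0
  rw [image_eq_zero_of_notMem_tsupport h, zero_mul]

theorem formIntegral_eq_sum (o : ManifoldOrientation S) (L : LorentzStructure V) (η : Form V 3 4) :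
    formIntegral o L η = ∑ x₀ ∈ activeCharts S, chartIntegral x₀ (weightedDensity o L x₀ η) := by
  simp only [chartIntegral_weightedDensity]
  refine finsum_eq_sum_of_support_subset _ fun x₀ hx₀ => ?_
  simp only [activeCharts, Set.Finite.coe_toFinset]
  intro h0
  apply hx₀
  simp [h0]

theorem formIntegral_add (o : ManifoldOrientation S) (L : LorentzStructure V) (η η' : Form V 3 4) :
    formIntegral o L (η + η') = formIntegral o L η + formIntegral o L η' := by
  simp only [formIntegral_eq_sum, ← Finset.sum_add_distrib, ← map_add]
  refine Finset.sum_congr rfl fun x₀ _ => congrArg _ (ContinuousMap.ext fun x => ?_)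
  change _ * density o L (η + η') x₀ x = _ * _ + _ * _
  rw [density_add, mul_add]

theorem formIntegral_smul (o : ManifoldOrientation S) (L : LorentzStructure V) (c : ℝ)
    (η : Form V 3 4) : formIntegral o L (c • η) = c * formIntegral o L η := by
  rw [formIntegral_eq_sum, formIntegral_eq_sum, Finset.mul_sum]
  refine Finset.sum_congr rfl fun x₀ _ => ?_
  rw [← smul_eq_mul, ← map_smul]
  refine congrArg _ (ContinuousMap.ext fun x => ?_)
  change _ * density o L (c • η) x₀ x = c * (_ * _)
  rw [density_of_smul o L (c := c) (η := η) rfl]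
  ring

/-- Currying a jointly continuous function on `X × S` gives a continuous map from `X` to `C(S, ℝ)`,
on which the finitely many chart integrals are bounded functionals. -/
theorem JointlyContinuous.continuous_formIntegral {X : Type*} [TopologicalSpace X]
    {H : X → Form V 3 4} (hH : JointlyContinuous H) (o : ManifoldOrientation S)
    (L : LorentzStructure V) : Continuous fun a => formIntegral o L (H a) := by
  simp only [formIntegral_eq_sum]
  refine continuous_finsetSum _ fun x₀ _ => (chartIntegral x₀).continuous.comp ?_
  exact (ContinuousMap.curry ⟨_, continuous_weightedDensity hH o L x₀⟩).continuous

theorem chartIntegral_nonneg {x₀ : S} {g : C(S, ℝ)} (hg : ∀ x, 0 ≤ g x) :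
    0 ≤ chartIntegral x₀ g :=
  setIntegral_nonneg (isCompact_chartSupport x₀).measurableSet fun _ _ => hg _

/-- In coordinates `g` is non-zero on a non-empty open set, which has positive Lebesgue measure; the
support condition places that set inside the domain of integration. -/
theorem chartIntegral_pos {x₀ x : S} {g : C(S, ℝ)} (hg : ∀ x, 0 ≤ g x)
    (hs : Function.support g ⊆ Function.support (chartPartition S x₀)) (hx : 0 < g x) :
    0 < chartIntegral x₀ g := by
  have hc : ContinuousOn (fun y => g ((chartAt E3 x₀).symm y)) (chartAt E3 x₀).target :=
    g.continuous.comp_continuousOn (chartAt E3 x₀).continuousOn_symm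
  have hsub : ∀ z, g z ≠ 0 → z ∈ tsupport (chartPartition S x₀) := fun z hz =>
    subset_tsupport _ (hs hz)
  change 0 < ∫ y in chartSupport S x₀, g ((chartAt E3 x₀).symm y)
  rw [setIntegral_pos_iff_support_of_nonneg_ae (Filter.Eventually.of_forall fun y => hg _)
    (integrableOn_chartSupport x₀ g)]
  have hxs : x ∈ (chartAt E3 x₀).source := chartPartition_isSubordinate x₀ (hsub x hx.ne')
  have ho : IsOpen ((chartAt E3 x₀).target ∩ (fun y => g ((chartAt E3 x₀).symm y)) ⁻¹' {0}ᶜ) :=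
    hc.isOpen_inter_preimage (chartAt E3 x₀).open_target isOpen_compl_singleton
  have hne : ((chartAt E3 x₀).target ∩ (fun y => g ((chartAt E3 x₀).symm y)) ⁻¹' {0}ᶜ).Nonempty :=
    ⟨chartAt E3 x₀ x, (chartAt E3 x₀).map_source hxs, by
      simp only [Set.mem_preimage, (chartAt E3 x₀).left_inv hxs]; exact hx.ne'⟩
  refine (ho.measure_pos volume hne).trans_le (measure_mono fun y hy => ⟨hy.2, ?_⟩)
  exact ⟨_, hsub _ hy.2, (chartAt E3 x₀).right_inv hy.1⟩

/-- A top form which is positive at a point has a positive integral after multiplication by a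
suitable cut-off function. -/
theorem exists_formIntegral_pos (o : ManifoldOrientation S) (L : LorentzStructure V)
    (η : Form V 3 4) {x : S} (hx : 0 < density o L η x x) :
    ∃ (f : S → ℝ) (hf : ContMDiff (𝓡 3) 𝓘(ℝ) ∞ f), 0 < formIntegral o L (functionSmul f hf η) := by
  have hc : ContinuousOn (fun z => density o L η x z) (chartAt E3 x).source :=
    (jointlyContinuous_id.continuousOn_density o L x).comp (f := fun z => (η, z)) (by fun_prop)
      fun z hz => ⟨trivial, hz⟩
  have hN : (chartAt E3 x).source ∩ (fun z => density o L η x z) ⁻¹' Set.Ioi 0 ∈ 𝓝 x :=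
    (hc.isOpen_inter_preimage (chartAt E3 x).open_source isOpen_Ioi).mem_nhds
      ⟨mem_chart_source E3 x, hx⟩
  obtain ⟨f, hfN, -⟩ := (SmoothBumpFunction.nhds_basis_support (I := 𝓡 3) hN).mem_iff.1 hN
  refine ⟨f, f.contMDiff, ?_⟩
  have hd : ∀ x₀ z, density o L (functionSmul f f.contMDiff η) x₀ z = f z * density o L η x₀ z :=
    fun x₀ z => density_of_smul o L rfl x₀
  -- The bump `f` is supported where the density in the chart at `x` is positive, and positivity
  -- passes to all other charts. All terms of the integral are then non-negative.
  have hpos : ∀ x₀ z, z ∈ (chartAt E3 x₀).source → 0 ≤ f z * density o L η x₀ z := by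
    intro x₀ z hz
    by_cases hfz : f z = 0
    · rw [hfz, zero_mul]
    · obtain ⟨h1, h2⟩ := hfN (subset_tsupport _ hfz)
      exact mul_nonneg f.nonneg ((density_pos_iff o L η hz h1).2 h2).le
  have hw : ∀ x₀ z, 0 ≤ weightedDensity o L x₀ (functionSmul f f.contMDiff η) z := by
    intro x₀ z
    change 0 ≤ chartPartition S x₀ z * density o L _ x₀ z
    by_cases hz : chartPartition S x₀ z = 0
    · rw [hz, zero_mul]
    · rw [hd]
      exact mul_nonneg ((chartPartition S).nonneg x₀ z)
        (hpos x₀ z (chartPartition_isSubordinate x₀ (subset_tsupport _ hz)))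
  -- Some partition function is positive at `x`; its chart contributes strictly.
  obtain ⟨x₀, hx₀⟩ := (chartPartition S).exists_pos_of_mem (Set.mem_univ x)
  rw [formIntegral_eq_sum]
  refine Finset.sum_pos' (fun z _ => chartIntegral_nonneg (hw z)) ⟨x₀, ?_, ?_⟩
  · simp only [activeCharts, Set.Finite.mem_toFinset]
    intro h0
    rw [show chartPartition S x₀ x = 0 from congrFun h0 x] at hx₀
    exact lt_irrefl _ hx₀
  · refine chartIntegral_pos (x := x) (hw x₀) (fun z hz h0 => hz ?_) ?_
    · change chartPartition S x₀ z * _ = 0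
      rw [h0, zero_mul]
    · change 0 < chartPartition S x₀ x * density o L _ x₀ x
      rw [hd, f.eq_one, one_mul]
      exact mul_pos hx₀ ((density_pos_iff o L η
        (chartPartition_isSubordinate x₀ (subset_tsupport _ hx₀.ne')) (mem_chart_source E3 x)).2 hx)

theorem exists_formIntegral_ne_zero (o : ManifoldOrientation S) (L : LorentzStructure V)
    (η : Form V 3 4) {x : S} (hx : volumeCoeff L x (coordFrame x x) (η.val x) ≠ 0) :
    ∃ (f : S → ℝ) (hf : ContMDiff (𝓡 3) 𝓘(ℝ) ∞ f), formIntegral o L (functionSmul f hf η) ≠ 0 := by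
  have hd : density o L η x x ≠ 0 := by
    rw [density_eq]
    refine mul_ne_zero ?_ hx
    rw [coordSign]
    split_ifs <;> simp
  rcases hd.lt_or_gt with h | h
  · obtain ⟨f, hf, hp⟩ := exists_formIntegral_pos o L ((-1 : ℝ) • η) (x := x) (by
      rw [density_of_smul o L (c := -1) (η := η) rfl]; linarith)
    refine ⟨f, hf, fun h0 => ?_⟩
    have e : functionSmul f hf ((-1 : ℝ) • η) = (-1 : ℝ) • functionSmul f hf η :=
      Form.ext (funext fun z => smul_comm (f z) (-1 : ℝ) (η.val z))
    rw [e, formIntegral_smul, h0, mul_zero] at hp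
    exact lt_irrefl _ hp
  · obtain ⟨f, hf, hp⟩ := exists_formIntegral_pos o L η h
    exact ⟨f, hf, hp.ne'⟩

end Integral

/-! ### The canonical symplectic form and the isomorphism of phase spaces -/

section Symplectic

variable {S : Type*} [TopologicalSpace S] [ChartedSpace E3 S] [IsManifold (𝓡 3) ∞ S]
  [T2Space S] [CompactSpace S]
  {V : S → Type*} [TopologicalSpace (TotalSpace F4 V)] [∀ x, AddCommGroup (V x)]
  [∀ x, Module ℝ (V x)] [∀ x, TopologicalSpace (V x)] [FiberBundle F4 V] [VectorBundle ℝ F4 V]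

theorem wedge_add {i j k l : ℕ} (α : Form V i j) (β γ : Form V k l) :
    wedge α (β + γ) = wedge α β + wedge α γ :=
  Form.ext (funext fun x => fibreWedge_add (α.val x) (β.val x) (γ.val x))

theorem wedge_smul {i j k l : ℕ} (c : ℝ) (α : Form V i j) (β : Form V k l) :
    wedge α (c • β) = c • wedge α β :=
  Form.ext (funext fun x => fibreWedge_smul c (α.val x) (β.val x))

theorem add_wedge {i j k l : ℕ} (α γ : Form V i j) (β : Form V k l) :
    wedge (α + γ) β = wedge α β + wedge γ β :=
  Form.ext (funext fun x => add_fibreWedge (α.val x) (γ.val x) (β.val x))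

theorem smul_wedge {i j k l : ℕ} (c : ℝ) (α : Form V i j) (β : Form V k l) :
    wedge (c • α) β = c • wedge α β :=
  Form.ext (funext fun x => smul_fibreWedge c (α.val x) (β.val x))

/-- The pairing of one-forms with two-forms by integration. -/
def integralPairing (o : ManifoldOrientation S) (L : LorentzStructure V) :
    Form V 1 1 →ₗ[ℝ] Form V 2 3 →ₗ[ℝ] ℝ :=
  LinearMap.mk₂ ℝ (fun b Θ => formIntegral o L (wedge b Θ))
    (fun b b' Θ => (congrArg (formIntegral o L) (add_wedge b b' Θ)).trans (formIntegral_add o L _ _))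
    (fun c b Θ => (congrArg (formIntegral o L) (smul_wedge c b Θ)).trans
      (formIntegral_smul o L c _))
    (fun b Θ Θ' => (congrArg (formIntegral o L) (wedge_add b Θ Θ')).trans
      (formIntegral_add o L _ _))
    (fun c b Θ => (congrArg (formIntegral o L) (wedge_smul c b Θ)).trans
      (formIntegral_smul o L c _))

theorem continuous_integralPairing (o : ManifoldOrientation S) (L : LorentzStructure V) :
    Continuous fun p : Form V 1 1 × Form V 2 3 => integralPairing o L p.1 p.2 :=
  JointlyContinuous.continuous_formIntegral
    (H := fun p : Form V 1 1 × Form V 2 3 => (wedge p.1 p.2 : Form V (1 + 2) (1 + 3)))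
    ((jointlyContinuous_id.comp continuous_fst).wedge (jointlyContinuous_id.comp continuous_snd)) o L

theorem canonicalForm_eq (o : ManifoldOrientation S) (L : LorentzStructure V)
    (p q : CotangentSpace V) :
    canonicalForm o L p q = integralPairing o L p.1 q.2 - integralPairing o L q.1 p.2 := rfl

theorem exists_vol_frame_ne_zero (L : LorentzStructure V) (x : S) :
    ∃ f : Module.Basis (Fin 4) ℝ (V x), L.vol x f ≠ 0 := by
  obtain ⟨f, -, hf⟩ := L.exists_frame x
  exact ⟨f, by rw [hf]; exact one_ne_zero⟩

variable [ContMDiffVectorBundle ∞ F4 V (𝓡 3)]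

/-- Every element of a fibre is the value of a smooth form. -/
theorem exists_form_val_eq {i j : ℕ} (x : S)
    (α : (TangentSpace (𝓡 3) x) [⋀^Fin i]→ₗ[ℝ] ⋀[ℝ]^j (V x)) :
    ∃ β : Form V i j, β.val x = α := by
  obtain ⟨f, -, hf⟩ := (SmoothBumpFunction.nhds_basis_tsupport (I := 𝓡 3) x).mem_iff.1
    ((isOpen_nbhd (V := V) x).mem_nhds (mem_nbhd_self x))
  refine ⟨cutoffForm x f f.contMDiff hf (localRep x x α), ?_⟩
  change f x • localLift x x (localRep x x α) = α
  rw [f.eq_one, one_smul, localLift_localRep (mem_nbhd_self x)]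

theorem integralPairing_separatingLeft (o : ManifoldOrientation S) (L : LorentzStructure V)
    (b : Form V 1 1) (h : ∀ Θ, integralPairing o L b Θ = 0) : b = 0 := by
  by_contra hb
  obtain ⟨x, hx⟩ : ∃ x, b.val x ≠ 0 := by
    by_contra! hc
    exact hb (Form.ext (funext hc))
  obtain ⟨f, hf⟩ := exists_vol_frame_ne_zero L x
  obtain ⟨Θx, hΘ⟩ := exists_wedge_oneForm_ne_zero (coordBasis (mem_chart_source E3 x)) f (L.vol x) hf
    (b.val x) hx
  obtain ⟨Θ, rfl⟩ := exists_form_val_eq x Θx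
  rw [← eq_vec_three, coe_coordBasis] at hΘ
  obtain ⟨g, hg, hne⟩ := exists_formIntegral_ne_zero o L (wedge b Θ) (x := x) hΘ
  -- The cut-off is absorbed into the partner, so the non-zero integral is a value of the pairing
  -- with `b`.
  refine hne (Eq.trans (congrArg (formIntegral o L) ?_) (h (functionSmul g hg Θ)))
  exact Form.ext (funext fun z => (fibreWedge_smul (g z) (b.val z) (Θ.val z)).symm)

theorem integralPairing_separatingRight (o : ManifoldOrientation S) (L : LorentzStructure V)
    (Θ : Form V 2 3) (h : ∀ b, integralPairing o L b Θ = 0) : Θ = 0 := by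
  by_contra hb
  obtain ⟨x, hx⟩ : ∃ x, Θ.val x ≠ 0 := by
    by_contra! hc
    exact hb (Form.ext (funext hc))
  obtain ⟨f, hf⟩ := exists_vol_frame_ne_zero L x
  obtain ⟨bx, hb⟩ := exists_wedge_twoForm_ne_zero (coordBasis (mem_chart_source E3 x)) f (L.vol x) hf
    (Θ.val x) hx
  obtain ⟨b, rfl⟩ := exists_form_val_eq x bx
  rw [← eq_vec_three, coe_coordBasis] at hb
  obtain ⟨g, hg, hne⟩ := exists_formIntegral_ne_zero o L (wedge b Θ) (x := x) hb
  refine hne (Eq.trans (congrArg (formIntegral o L) ?_) (h (functionSmul g hg b)))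
  exact Form.ext (funext fun z => (smul_fibreWedge (g z) (b.val z) (Θ.val z)).symm)

theorem isSymplecticForm_canonicalForm (o : ManifoldOrientation S) (L : LorentzStructure V) :
    IsSymplecticForm (canonicalForm o L) where
  bilinear := by
    let B := (integralPairing o L).compl₁₂ (LinearMap.fst ℝ (Form V 1 1) (Form V 2 3))
      (LinearMap.snd ℝ (Form V 1 1) (Form V 2 3))
    exact ⟨B - B.flip, fun p q => rfl⟩
  continuous := by
    simp only [canonicalForm_eq]
    exact ((continuous_integralPairing o L).comp
      (g := fun p => integralPairing o L p.1 p.2)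
      (f := fun p : CotangentSpace V × CotangentSpace V => (p.1.1, p.2.2)) (by fun_prop)).sub
      ((continuous_integralPairing o L).comp
      (g := fun p => integralPairing o L p.1 p.2)
      (f := fun p : CotangentSpace V × CotangentSpace V => (p.2.1, p.1.2)) (by fun_prop))
  alternating p := sub_self _
  nondegenerate := by
    rintro ⟨b, Θ⟩ h
    refine Prod.ext (integralPairing_separatingLeft o L b fun Θ' => ?_)
      (integralPairing_separatingRight o L Θ fun b' => ?_)
    · have := h (0, Θ')
      rw [canonicalForm_eq, map_zero, LinearMap.zero_apply, sub_zero] at this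
      exact this
    · have := h (b', 0)
      rw [canonicalForm_eq, map_zero, zero_sub, neg_eq_zero] at this
      exact this

/-- A symplectic form is transported by a linear homeomorphism. -/
theorem IsSymplecticForm.comp_equiv {E E' : Type*} [AddCommGroup E] [Module ℝ E]
    [TopologicalSpace E] [AddCommGroup E'] [Module ℝ E'] [TopologicalSpace E'] {σ : E' → E' → ℝ}
    (hσ : IsSymplecticForm σ) (Φ : E ≃L[ℝ] E') : IsSymplecticForm fun p q => σ (Φ p) (Φ q) where
  bilinear := by
    obtain ⟨B, hB⟩ := hσ.bilinear
    exact ⟨B.compl₁₂ (Φ : E →ₗ[ℝ] E') (Φ : E →ₗ[ℝ] E'), fun p q => hB _ _⟩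
  continuous := hσ.continuous.comp
    (f := fun p : E × E => (Φ p.1, Φ p.2)) (by fun_prop)
  alternating p := hσ.alternating _
  nondegenerate p h := by
    have : Φ p = 0 := hσ.nondegenerate _ fun q => by
      obtain ⟨q, rfl⟩ := Φ.surjective q
      exact h q
    simpa using this

theorem finrank_fibre (L : LorentzStructure V) (x : S) : Module.finrank ℝ (V x) = 4 := by
  obtain ⟨f, -⟩ := L.exists_frame x
  rw [Module.finrank_eq_card_basis f, Fintype.card_fin]

theorem exists_continuous_rightInverse_wedgeLeft (L : LorentzStructure V) (e₀ : Form V 1 1)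
    (he₀ : IsBoundaryCoframe e₀) : ∃ R : Form V 2 3 →ₗ[ℝ] Form V 1 2, Continuous R ∧
      ∀ Θ, wedgeLeft e₀ 1 2 (R Θ) = Θ :=
  exists_continuous_rightInverse (i' := 1 + 1) (j' := 1 + 2)
    (fun x =>
      { toFun := fun a => fibreWedge (e₀.val x) a
        map_add' := fibreWedge_add (e₀.val x)
        map_smul' := fun c => fibreWedge_smul c (e₀.val x) })
    (fun x Θ => fibreWedge_surjective (coordBasis (mem_chart_source E3 x)) (finrank_fibre L x)
      (e₀.val x) (he₀ x) Θ)
    (wedgeLeft e₀ 1 2) fun _ _ => rfl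

/-- Components of `e₀ ∧ α` are linear in those of `α`, with smooth coefficients built from the
components of `e₀`. -/
theorem continuous_wedgeLeft (e₀ : Form V 1 1) (i j : ℕ) : Continuous (wedgeLeft e₀ i j) := by
  refine continuous_of_local_matrix (wedgeLeft e₀ i j) fun x₀ v m => ?_
  refine ⟨Equiv.Perm.ModSumCongr (Fin 1) (Fin i) × Fin (Module.finrank ℝ (⋀[ℝ]^1 F4)) ×
      Fin (Module.finrank ℝ (⋀[ℝ]^j F4)), inferInstance,
    fun c x => (-1 : ℝ) ^ (1 * i) * (((Equiv.Perm.sign c.1.out : ℤ) : ℝ) *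
      (component e₀.val x₀ (fun n => v (finSumFinEquiv (c.1.out (Sum.inl n))))
        ((Module.finBasis ℝ (⋀[ℝ]^1 F4)).coord c.2.1) x *
      m (extMul 1 j (Module.finBasis ℝ (⋀[ℝ]^1 F4) c.2.1) (Module.finBasis ℝ (⋀[ℝ]^j F4) c.2.2)))),
    fun c => evalDual (fun n => v (finSumFinEquiv (c.1.out (Sum.inr n))))
      ((Module.finBasis ℝ (⋀[ℝ]^j F4)).coord c.2.2), fun c => ?_, fun α x _ => ?_⟩
  · exact contMDiffOn_const.mul (contMDiffOn_const.mul ((e₀.smooth _ _ _).mul contMDiffOn_const))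
  · refine (congrFun (component_wedge e₀.val α.val x₀ v m) x).trans ?_
    simp only [← component_eq, Fintype.sum_prod_type, Finset.mul_sum]
    refine Finset.sum_congr rfl fun q _ => Finset.sum_congr rfl fun a _ =>
      Finset.sum_congr rfl fun b _ => ?_
    ring

/-- The isomorphism `(b, [a]) ↦ (b, e₀ ∧ a)`. -/
theorem exists_phaseSpaceEquiv (L : LorentzStructure V) (e₀ : Form V 1 1)
    (he₀ : IsBoundaryCoframe e₀) : ∃ Φ : PhaseSpace e₀ ≃L[ℝ] CotangentSpace V,
      ∀ (b : Form V 1 1) (a : Form V 1 2),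
        Φ (b, Submodule.Quotient.mk a) = (b, wedge e₀ a) := by
  obtain ⟨R, hRc, hR⟩ := exists_continuous_rightInverse_wedgeLeft L e₀ he₀
  let A : Form V 1 2 →ₗ[ℝ] Form V 2 3 := wedgeLeft e₀ 1 2
  let Ψ : (Form V 1 2 ⧸ LinearMap.ker (wedgeLeft e₀ 1 2)) ≃ₗ[ℝ] Form V 2 3 :=
    A.quotKerEquivOfSurjective fun Θ => ⟨R Θ, hR Θ⟩
  have hΨ : ∀ a, Ψ (Submodule.Quotient.mk a) = A a := fun a => rfl
  -- The inverse is the class of the right inverse, hence a composite of continuous maps.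
  have hΨs : ∀ Θ, Ψ.symm Θ = Submodule.Quotient.mk (R Θ) := fun Θ => by
    rw [LinearEquiv.symm_apply_eq, hΨ]
    exact (hR Θ).symm
  have hc : Continuous Ψ := continuous_quot_lift _ (continuous_wedgeLeft e₀ 1 2)
  have hcs : Continuous Ψ.symm := by
    have : ⇑Ψ.symm = fun Θ => Submodule.Quotient.mk (R Θ) := funext hΨs
    rw [this]
    exact continuous_quot_mk.comp hRc
  let Ψc : (Form V 1 2 ⧸ LinearMap.ker (wedgeLeft e₀ 1 2)) ≃L[ℝ] Form V 2 3 :=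
    { Ψ with
      continuous_toFun := hc
      continuous_invFun := hcs }
  exact ⟨(ContinuousLinearEquiv.refl ℝ (Form V 1 1)).prodCongr Ψc, fun b a => rfl⟩

end Symplectic

end LPC

end

/-! ### The theorem -/

theorem mainTheorem11
    {S : Type*} [TopologicalSpace S] [ChartedSpace LPC.E3 S] [IsManifold (𝓡 3) ∞ S]
    [T2Space S] [CompactSpace S] (o : LPC.ManifoldOrientation S)
    (V : S → Type*) [TopologicalSpace (TotalSpace LPC.F4 V)] [∀ x, AddCommGroup (V x)]
    [∀ x, Module ℝ (V x)] [∀ x, TopologicalSpace (V x)] [FiberBundle LPC.F4 V]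
    [VectorBundle ℝ LPC.F4 V] [ContMDiffVectorBundle ∞ LPC.F4 V (𝓡 3)]
    (L : LPC.LorentzStructure V) (e₀ : LPC.Form V 1 1) (he₀ : LPC.IsBoundaryCoframe e₀) :
    LPC.IsSymplecticForm (LPC.canonicalForm o L) ∧
    ∃ ϖ : LPC.PhaseSpace e₀ → LPC.PhaseSpace e₀ → ℝ,
      (∀ (b b' : LPC.Form V 1 1) (a a' : LPC.Form V 1 2),
        ϖ (b, Submodule.Quotient.mk a) (b', Submodule.Quotient.mk a') =
          LPC.preForm o L e₀ (b, a) (b', a')) ∧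
      LPC.IsSymplecticForm ϖ ∧
      ∃ Φ : LPC.PhaseSpace e₀ ≃L[ℝ] LPC.CotangentSpace V,
        (∀ (b : LPC.Form V 1 1) (a : LPC.Form V 1 2),
          Φ (b, Submodule.Quotient.mk a) = (b, LPC.wedge e₀ a)) ∧
        ∀ p q : LPC.PhaseSpace e₀, LPC.canonicalForm o L (Φ p) (Φ q) = ϖ p q := by
  have hσ := LPC.isSymplecticForm_canonicalForm o L
  obtain ⟨Φ, hΦ⟩ := LPC.exists_phaseSpaceEquiv L e₀ he₀
  -- With the pullback as the form, only its formula on representatives remains, and that formula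
  -- also shows independence of the representatives.
  refine ⟨hσ, fun p q => LPC.canonicalForm o L (Φ p) (Φ q), fun b b' a a' => ?_,
    hσ.comp_equiv Φ, Φ, hΦ, fun p q => rfl⟩
  have key : ∀ (b : LPC.Form V 1 1) (a : LPC.Form V 1 2),
      (LPC.wedge b (LPC.wedge e₀ a) : LPC.Form V 3 4) = LPC.wedge (LPC.wedge e₀ b) a :=
    fun b a => LPC.Form.ext (funext fun x =>
      LPC.fibreWedge_left_comm (b.val x) (e₀.val x) (a.val x))
  change LPC.canonicalForm o L (Φ (b, Submodule.Quotient.mk a))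
    (Φ (b', Submodule.Quotient.mk a')) = _
  rw [hΦ, hΦ]
  change LPC.formIntegral o L (LPC.wedge b (LPC.wedge e₀ a')) -
    LPC.formIntegral o L (LPC.wedge b' (LPC.wedge e₀ a)) = _
  rw [key, key]
  rfl
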